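/- Let $n\ge 1$, $\mathbb T^n=(\mathbb R/2\pi\mathbb Z)^n$ with coordinates $y^1,\dots,y^n$, fix an index $\alpha_0$ and write $y=y^{\alpha_0}$. There exist smooth nondecreasing functions $\eta:\mathbb R\to\mathbb R$ with $\eta=1$ on $[1,\infty)$, $\eta=-1$ on $(-\infty,-1)$ and $\eta(x)=x$ for $|x|\le\frac12$. For any such $\eta$ put $$f(y,\rho)=2\int_\rho^1\eta\Big(\frac{\sin y}{s}\Big)\,ds,\qquad \overline g=d\rho^2+e^{f(y,\rho)}\,\delta_{\alpha\beta}\,dy^\alpha dy^\beta,\qquad g=\rho^{-2}\,\overline g ,\qquad 0<\rho<1 .$$ Then $g$ is a smooth Riemannian metric on the end $\mathbb T^n\times(0,1)$ with the following properties. 1. $g$ is complete towards $\rho=0$: for every $a\in(0,1)$ the set $\mathbb T^n\times(0,a]$ is complete for the Riemannian distance of $(\mathbb T^n\times(0,1),g)$. 2. There is a constant $C$ such that, at every point of $\mathbb T^n\times(0,1)$, all sectional curvatures of $g$ satisfy $|\sec+1|\le C\rho$, and $|\nabla_g \mathrm{Rm}|_g\le C\rho$. 3. $\rho$ is a geodesic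 defining function for the boundary $\mathbb T^n\times\{0\}$ of $\mathbb T^n\times[0,1)$, that is, a smooth defining function with $|d\rho|_{\overline g}\equiv1$, and $\overline g=\rho^2g$ extends to a continuous metric on $\mathbb T^n\times[0,1)$. 4. $\partial_y\overline g_{ij}=O(\log\rho)$ for all components, uniformly on $\mathbb T^n\times(0,1)$, but for every $\alpha$ the function $\partial_y\overline g_{\alpha\alpha}$ is unbounded on $\mathbb T^n\times(0,a)$ for every $a\in(0,1]$. 5. The compactification is not Lipschitz: for no $a\in(0,1]$ does $\overline g$ extend to a (locally) Lipschitz Riemannian metric on $\mathbb T^n\times[0,a)$. Nor does $\sigma^2g$, for any $C^1$ geodesic defining function $\sigma$ of the boundary $\mathbb T^n\times\{0\}$ on $\mathbb T^n\times[0,a)$ (that is, $\sigma$ is $C^1$ up to the boundary, $\sigma>0$ for $\rho>0$, $\sigma=0$ and $d\sigma\ne0$ for $\rho=0$, and $|d\sigma|_{\sigma^2g}\equiv1$ for $\rho>0$). -/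

import Mathlib

open Filter Topology
open scoped ContDiff ENNReal

noncomputable section

namespace AHExample

/-! ## Riemannian geometry in global coordinates

Points of `ℝⁿ⁺¹` are written `x = (x⁰, x¹, …, xⁿ) = (ρ, y¹, …, yⁿ)`. The index `0` is the direction
of `ρ`, and `α.succ`, for `α : Fin n`, is the direction of the tangential coordinate `y^α`.
A metric on a subset of `ℝⁿ⁺¹` is given by its matrix of components. -/

/-- Coordinates `(ρ, y¹, …, yⁿ)`. -/
abbrev Coord (n : ℕ) : Type := Fin (n + 1) → ℝ

/-- Matrix-valued functions on coordinate space: symmetric 2-tensors in components. -/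
abbrev MetricField (n : ℕ) : Type := Coord n → Matrix (Fin (n + 1)) (Fin (n + 1)) ℝ

/-- The coordinate derivative `∂_i F` at `x`. -/
def pd {n : ℕ} (i : Fin (n + 1)) (F : Coord n → ℝ) (x : Coord n) : ℝ :=
  fderiv ℝ F x (Pi.single i 1)

/-- The value `g_x(v, w)`. -/
def metricVal {n : ℕ} (g : MetricField n) (x v w : Coord n) : ℝ :=
  ∑ i, ∑ j, g x i j * v i * w j

/-- Christoffel symbols of the Levi-Civita connection:
`Γ^k_{ij} = ½ g^{kl} (∂_i g_{jl} + ∂_j g_{il} - ∂_l g_{ij})`. -/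
def christoffel {n : ℕ} (g : MetricField n) (k i j : Fin (n + 1)) (x : Coord n) : ℝ :=
  (1 / 2) * ∑ l, (g x)⁻¹ k l *
    (pd i (fun z => g z j l) x + pd j (fun z => g z i l) x - pd l (fun z => g z i j) x)

/-- The components `R_{ijk}^l` of the curvature endomorphism, `R(∂_i, ∂_j) ∂_k = R_{ijk}^l ∂_l`,
where `R(X, Y) Z = ∇_X ∇_Y Z - ∇_Y ∇_X Z - ∇_{[X, Y]} Z`. -/
def curvEndo {n : ℕ} (g : MetricField n) (i j k l : Fin (n + 1)) (x : Coord n) : ℝ :=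
  pd i (christoffel g l j k) x - pd j (christoffel g l i k) x
    + ∑ m, (christoffel g m j k x * christoffel g l i m x
        - christoffel g m i k x * christoffel g l j m x)

/-- The Riemann curvature 4-tensor `R_{ijkl} = R_{ijk}^m g_{ml}`. -/
def Rm {n : ℕ} (g : MetricField n) (i j k l : Fin (n + 1)) (x : Coord n) : ℝ :=
  ∑ m, curvEndo g i j k m x * g x m l

/-- `Rm(X, Z, Z, X)`; for `g`-orthonormal `X`, `Z` this is the sectional curvature of the plane
they span. -/
def sec {n : ℕ} (g : MetricField n) (x X Z : Coord n) : ℝ :=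
  ∑ i, ∑ j, ∑ k, ∑ l, Rm g i j k l x * X i * Z j * Z k * X l

/-- The vectors `X`, `Z` at `x` are orthonormal for `g`. -/
def IsOrthonormalPair {n : ℕ} (g : MetricField n) (x X Z : Coord n) : Prop :=
  metricVal g x X X = 1 ∧ metricVal g x Z Z = 1 ∧ metricVal g x X Z = 0

/-- The components `∇_m R_{ijkl}` of the covariant derivative of the curvature tensor. -/
def covRm {n : ℕ} (g : MetricField n) (m i j k l : Fin (n + 1)) (x : Coord n) : ℝ :=
  pd m (Rm g i j k l) x
    - ∑ s, (christoffel g s m i x * Rm g s j k l x + christoffel g s m j x * Rm g i s k l x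
        + christoffel g s m k x * Rm g i j s l x + christoffel g s m l x * Rm g i j k s x)

/-- The norm, for `g`, at `x`, of a covariant tensor of rank `r` with components `T`:
`|T|_g² = g^{i₁j₁} ⋯ g^{i_r j_r} T_{i₁⋯i_r} T_{j₁⋯j_r}`. -/
def tensorNorm {n r : ℕ} (g : MetricField n) (x : Coord n) (T : (Fin r → Fin (n + 1)) → ℝ) : ℝ :=
  Real.sqrt (∑ I : Fin r → Fin (n + 1), ∑ J : Fin r → Fin (n + 1),
    (∏ a, (g x)⁻¹ (I a) (J a)) * T I * T J)

/-- `|∇Rm|_g` at `x`. -/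
def normCovRm {n : ℕ} (g : MetricField n) (x : Coord n) : ℝ :=
  tensorNorm g x (fun I : Fin 5 → Fin (n + 1) => covRm g (I 0) (I 1) (I 2) (I 3) (I 4) x)

/-- `|dσ|_g` at `x`. -/
def normDiff {n : ℕ} (g : MetricField n) (σ : Coord n → ℝ) (x : Coord n) : ℝ :=
  tensorNorm g x (fun I : Fin 1 → Fin (n + 1) => pd (I 0) σ x)

/-! ## The end `𝕋ⁿ × (0, 1)` and its closure `𝕋ⁿ × [0, 1)`

`𝕋ⁿ = (ℝ / 2πℤ)ⁿ`. Functions and tensors on `𝕋ⁿ × (0, a)` are those on the covering space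
`{0 < ρ < a} ⊆ ℝⁿ⁺¹` that are `2π`-periodic in each `y^α`. -/

/-- The cover `{0 < ρ < a}` of `𝕋ⁿ × (0, a)`. -/
def openCollar (n : ℕ) (a : ℝ) : Set (Coord n) := {x | 0 < x 0 ∧ x 0 < a}

/-- The cover `{0 ≤ ρ < a}` of `𝕋ⁿ × [0, a)`. -/
def closedCollar (n : ℕ) (a : ℝ) : Set (Coord n) := {x | 0 ≤ x 0 ∧ x 0 < a}

/-- `F` is `2π`-periodic in `y¹, …, yⁿ` on `S`. -/
def IsPeriodicOn {n : ℕ} {E : Type*} (F : Coord n → E) (S : Set (Coord n)) : Prop :=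
  ∀ x ∈ S, ∀ α : Fin n, F (x + Pi.single α.succ (2 * Real.pi)) = F x

/-- The torus `𝕋ⁿ = (ℝ / 2πℤ)ⁿ`. -/
abbrev Torus (n : ℕ) : Type := Fin n → AddCircle (2 * Real.pi)

/-- The covering map `(ρ, y) ↦ ([y], ρ)`. -/
def proj {n : ℕ} (x : Coord n) : Torus n × ℝ :=
  (fun α => ((x α.succ : ℝ) : AddCircle (2 * Real.pi)), x 0)

/-- The length `∫₀¹ |γ'(t)|_g dt` of a curve. -/
def curveLength {n : ℕ} (g : MetricField n) (γ : ℝ → Coord n) : ℝ≥0∞ :=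
  ∫⁻ t in Set.Icc (0 : ℝ) 1,
    ENNReal.ofReal (Real.sqrt (metricVal g (γ t) (deriv γ t) (deriv γ t)))

/-- The Riemannian distance on `𝕋ⁿ × (0, 1)` of a periodic metric `g`: the infimum of the lengths of
the `C¹` curves in `𝕋ⁿ × (0, 1)` from `p` to `q`, each represented by a lift to the cover. -/
def riemDist {n : ℕ} (g : MetricField n) (p q : Torus n × ℝ) : ℝ≥0∞ :=
  ⨅ γ : {γ : ℝ → Coord n // ContDiff ℝ 1 γ ∧ (∀ t ∈ Set.Icc (0 : ℝ) 1, γ t ∈ openCollar n 1) ∧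
    proj (γ 0) = p ∧ proj (γ 1) = q}, curveLength g γ.1

/-- The end is complete towards `ρ = 0`: for each `0 < a < 1`, every sequence in `𝕋ⁿ × (0, a]` that
is Cauchy for the Riemannian distance converges, for that distance, to a point of `𝕋ⁿ × (0, a]`. -/
def IsCompleteEnd {n : ℕ} (g : MetricField n) : Prop :=
  ∀ a : ℝ, 0 < a → a < 1 → ∀ u : ℕ → Torus n × ℝ,
    (∀ k, 0 < (u k).2 ∧ (u k).2 ≤ a) →
    (∀ ε : ℝ≥0∞, 0 < ε → ∃ N : ℕ, ∀ k ≥ N, ∀ m ≥ N, riemDist g (u k) (u m) < ε) →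
    ∃ p : Torus n × ℝ, (0 < p.2 ∧ p.2 ≤ a) ∧
      Tendsto (fun k => riemDist g (u k) p) atTop (𝓝 0)

/-- `g` is a smooth Riemannian metric on `𝕋ⁿ × (0, 1)`. -/
structure IsSmoothMetric {n : ℕ} (g : MetricField n) : Prop where
  smooth : ∀ i j, ContDiffOn ℝ ∞ (fun x => g x i j) (openCollar n 1)
  posDef : ∀ x ∈ openCollar n 1, (g x).PosDef
  periodic : IsPeriodicOn g (openCollar n 1)

/-- `h'` is a (pointwise positive definite) metric on `𝕋ⁿ × [0, a)` that extends the metric `h` on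
`𝕋ⁿ × (0, a)`. -/
structure IsMetricExtension {n : ℕ} (a : ℝ) (h h' : MetricField n) : Prop where
  extends_eq : ∀ x ∈ openCollar n a, h' x = h x
  posDef : ∀ x ∈ closedCollar n a, (h' x).PosDef
  periodic : IsPeriodicOn h' (closedCollar n a)

/-- `h` extends to a continuous metric on `𝕋ⁿ × [0, a)`. -/
def ExtendsContinuously {n : ℕ} (a : ℝ) (h : MetricField n) : Prop :=
  ∃ h' : MetricField n, IsMetricExtension a h h' ∧
    ∀ i j, ContinuousOn (fun x => h' x i j) (closedCollar n a)

/-- `h` extends to a `C^{0,1}` (Lipschitz) metric on `𝕋ⁿ × [0, a)`. -/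
def ExtendsLipschitz {n : ℕ} (a : ℝ) (h : MetricField n) : Prop :=
  ∃ h' : MetricField n, IsMetricExtension a h h' ∧
    ∀ i j, LocallyLipschitzOn (closedCollar n a) (fun x => h' x i j)

/-- `σ² g`. -/
def rescale {n : ℕ} (σ : Coord n → ℝ) (g : MetricField n) : MetricField n :=
  fun x => (σ x) ^ 2 • g x

/-- `σ` is a `C^k` geodesic defining function, for the metric `g`, on the collar `𝕋ⁿ × [0, a)` of the
boundary `𝕋ⁿ × {0}`: a defining function of the boundary with `|dσ|_{σ² g} ≡ 1`. -/
structure IsGeodesicDefiningFunction {n : ℕ} (k : WithTop ℕ∞) (a : ℝ) (g : MetricField n)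
    (σ : Coord n → ℝ) : Prop where
  contDiffOn : ContDiffOn ℝ k σ (closedCollar n a)
  periodic : IsPeriodicOn σ (closedCollar n a)
  pos : ∀ x ∈ openCollar n a, 0 < σ x
  eq_zero : ∀ x ∈ closedCollar n a, x 0 = 0 → σ x = 0
  diff_ne_zero : ∀ x ∈ closedCollar n a, x 0 = 0 → fderivWithin ℝ σ (closedCollar n a) x ≠ 0
  geodesic : ∀ x ∈ openCollar n a, normDiff (rescale σ g) σ x = 1

/-! ## The example -/

/-- The cutoffs used in the construction. (The first three derivatives of such a function are
automatically bounded, and its values lie in `[-1, 1]`.) -/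
structure IsCutoff (η : ℝ → ℝ) : Prop where
  smooth : ContDiff ℝ ∞ η
  mono : Monotone η
  eq_one : ∀ x : ℝ, 1 ≤ x → η x = 1
  eq_neg_one : ∀ x : ℝ, x < -1 → η x = -1
  eq_self : ∀ x ∈ Set.Icc (-(1 / 2) : ℝ) (1 / 2), η x = x

/-- `f(y, ρ) = 2 ∫_ρ^1 η(sin y / s) ds`. -/
def potential (η : ℝ → ℝ) (y ρ : ℝ) : ℝ := 2 * ∫ s in ρ..1, η (Real.sin y / s)

/-- `ḡ = dρ² + e^{f(y, ρ)} δ_{αβ} dy^α dy^β`, where `y = y^{α₀}`. -/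
def gBar {n : ℕ} (η : ℝ → ℝ) (α₀ : Fin n) : MetricField n := fun x =>
  Matrix.diagonal fun i => if i = 0 then 1 else Real.exp (potential η (x α₀.succ) (x 0))

/-- `g = ρ⁻² ḡ`. -/
def gMetric {n : ℕ} (η : ℝ → ℝ) (α₀ : Fin n) : MetricField n := fun x =>
  ((x 0) ^ 2)⁻¹ • gBar η α₀ x

end AHExample

end

open AHExample

/-! Write a = ½∂_ρf = -η(sin y/ρ) and b = ½∂_yf = cos y ∫_ρ^1 η'(sin y/s) ds/s. The function η and
its derivatives are bounded and η' vanishes outside [-1, 1], so a is bounded, b = O(|log ρ|), and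
every second derivative of f is O(1/ρ). Each further derivative costs one more power of ρ. So f is
bounded and continuous up to ρ = 0, and b diverges only logarithmically. At y = 0 it does diverge:
η'(0) = 1 gives b = -log ρ.

Curvature. The ρ^{-2} terms of R_{ijk}^l are those of constant curvature -1. What remains
(`curvEndo_gMetric`) is linear in f'' and in a/ρ, a², b², with bounded coefficients, hence O(1/ρ),
because b = O(ρ^{-1/2}). Lowering an index gives a defect of size O(ρ^{-3}). Components of unit
vectors are O(ρ), so |sec + 1| = O(ρ^4 ρ^{-3}). Since g is parallel, only the defect contributes to
∇Rm (`covRm_gMetric`). Its components are O(ρ^{-4}), and five inverse metrics give |∇Rm|² = O(ρ^{10}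
ρ^{-8}).

Completeness. g is uniformly comparable to the hyperbolic metric ρ^{-2}(dρ² + |dy|²), so log ρ and y
are Lipschitz for the distance. Cauchy sequences therefore stay away from ρ = 0 and converge.

Failure of Lipschitz. Every σ²g is a pointwise multiple w ḡ. Its components include w and w e^f. If
both were Lipschitz, with w bounded below near the boundary point 0, then e^f would be Lipschitz
there, against ∂_y e^f = -2 log ρ at y = 0. This uses only the conformal class
(`not_extendsLipschitz_of_conformal`). -/

namespace AHExample

/-! ### Existence of a cutoff -/

/-- A smooth transition from `0` on `(-∞, 1/2]` to `1` on `[1, ∞)`. -/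
noncomputable def halfStep (x : ℝ) : ℝ := Real.smoothTransition (2 * x - 1)

/-- A smooth odd nondecreasing function which is the identity on `[-1/2, 1/2]` and `±1` outside
`(-1, 1)`. -/
noncomputable def standardCutoff (x : ℝ) : ℝ :=
  x + halfStep x * (1 - x) - halfStep (-x) * (1 + x)

lemma halfStep_of_le {x : ℝ} (hx : x ≤ 1 / 2) : halfStep x = 0 :=
  Real.smoothTransition.zero_of_nonpos (by linarith)

lemma halfStep_of_ge {x : ℝ} (hx : 1 ≤ x) : halfStep x = 1 :=
  Real.smoothTransition.one_of_one_le (by linarith)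

lemma standardCutoff_neg (x : ℝ) : standardCutoff (-x) = -standardCutoff x := by
  simp only [standardCutoff, neg_neg]; ring

/-- In this form monotonicity is visible: the subtracted product has two nonnegative nonincreasing
factors. The negative half-line then follows by oddness. -/
lemma standardCutoff_of_nonneg {x : ℝ} (hx : 0 ≤ x) :
    standardCutoff x = 1 - max (1 - x) 0 * (1 - halfStep x) := by
  rw [standardCutoff, halfStep_of_le (x := -x) (by linarith)]
  rcases le_total x 1 with h | h
  · rw [max_eq_left (by linarith)]; ring
  · rw [max_eq_right (by linarith), halfStep_of_ge h]; ring

lemma monotone_standardCutoff : Monotone standardCutoff := by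
  have key : MonotoneOn standardCutoff (Set.Ici 0) := by
    intro x hx y hy hxy
    rw [standardCutoff_of_nonneg hx, standardCutoff_of_nonneg hy]
    have h1 : halfStep x ≤ halfStep y := Real.smoothTransition.monotone (by linarith)
    have h2 : halfStep y ≤ 1 := Real.smoothTransition.le_one _
    have h3 : max (1 - y) 0 ≤ max (1 - x) 0 := max_le_max (by linarith) le_rfl
    have := mul_le_mul h3 (by linarith : 1 - halfStep y ≤ 1 - halfStep x) (by linarith)
      (le_max_right _ _)
    linarith
  refine MonotoneOn.Iic_union_Ici (a := 0) ?_ key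
  intro x hx y hy hxy
  have := key (a := -y) (b := -x) (by simpa using hy) (by simpa using hx) (by linarith)
  rw [standardCutoff_neg, standardCutoff_neg] at this
  linarith

theorem exists_isCutoff : ∃ η : ℝ → ℝ, IsCutoff η := by
  have hsm : ContDiff ℝ ∞ halfStep :=
    Real.smoothTransition.contDiff.comp (by fun_prop : ContDiff ℝ ∞ fun x : ℝ => 2 * x - 1)
  have h1 : ∀ x : ℝ, 1 ≤ x → standardCutoff x = 1 := fun x hx => by
    rw [standardCutoff, halfStep_of_ge hx, halfStep_of_le (by linarith)]; ring
  refine ⟨standardCutoff, ?_, monotone_standardCutoff, h1, fun x hx => ?_, fun x hx => ?_⟩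
  · have := hsm.comp (contDiff_neg (𝕜 := ℝ) (F := ℝ))
    unfold standardCutoff
    simp only [Function.comp_def] at this
    fun_prop
  · rw [← neg_neg x, standardCutoff_neg, h1 _ (by linarith)]
  · rw [standardCutoff, halfStep_of_le hx.2, halfStep_of_le (by linarith [hx.1])]; ring

/-! ### Functions that are constant near `±∞` -/

/-- Smooth functions which are constant on `(1, ∞)` and on `(-∞, -1)`. -/
structure IsTailConst (ψ : ℝ → ℝ) : Prop where
  smooth : ContDiff ℝ ∞ ψ
  right : ∃ c, ∀ x, 1 < x → ψ x = c
  left : ∃ c, ∀ x, x < -1 → ψ x = c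

lemma IsCutoff.isTailConst {η : ℝ → ℝ} (h : IsCutoff η) : IsTailConst η :=
  ⟨h.smooth, ⟨1, fun x hx => h.eq_one x hx.le⟩, ⟨-1, h.eq_neg_one⟩⟩

lemma IsCutoff.abs_le_one {η : ℝ → ℝ} (h : IsCutoff η) (x : ℝ) : |η x| ≤ 1 := by
  rw [abs_le]
  constructor
  · rw [← h.eq_neg_one (min x (-2)) (by linarith [min_le_right x (-2)])]
    exact h.mono (min_le_left _ _)
  · rw [← h.eq_one (max x 1) (le_max_right _ _)]
    exact h.mono (le_max_left _ _)

namespace IsTailConst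

variable {ψ : ℝ → ℝ}

lemma deriv_right (h : IsTailConst ψ) {x : ℝ} (hx : 1 < x) : deriv ψ x = 0 := by
  obtain ⟨c, hc⟩ := h.right
  have : ψ =ᶠ[𝓝 x] fun _ => c := by
    filter_upwards [lt_mem_nhds hx] with z hz using hc z hz
  rw [this.deriv_eq, deriv_const]

lemma deriv_left (h : IsTailConst ψ) {x : ℝ} (hx : x < -1) : deriv ψ x = 0 := by
  obtain ⟨c, hc⟩ := h.left
  have : ψ =ᶠ[𝓝 x] fun _ => c := by
    filter_upwards [gt_mem_nhds hx] with z hz using hc z hz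
  rw [this.deriv_eq, deriv_const]

lemma contDiff_deriv (h : IsTailConst ψ) : ContDiff ℝ ∞ (deriv ψ) :=
  (contDiff_infty_iff_deriv.1 h.smooth).2

lemma differentiable (h : IsTailConst ψ) : Differentiable ℝ ψ :=
  (contDiff_infty_iff_deriv.1 h.smooth).1

lemma hasDerivAt (h : IsTailConst ψ) (x : ℝ) : HasDerivAt ψ (deriv ψ x) x :=
  (h.differentiable x).hasDerivAt

lemma continuous (h : IsTailConst ψ) : Continuous ψ := h.differentiable.continuous

/-- Stability under ψ ↦ ψ' and ψ ↦ tψ'(t) is what makes the class usable: differentiating ψ(sin y/ρ)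
in y and ρ produces exactly these two functions, which are again bounded. -/
protected lemma deriv (h : IsTailConst ψ) : IsTailConst (deriv ψ) :=
  ⟨h.contDiff_deriv, ⟨0, fun _ hx => h.deriv_right hx⟩, ⟨0, fun _ hx => h.deriv_left hx⟩⟩

lemma id_mul_deriv (h : IsTailConst ψ) : IsTailConst (fun x => x * deriv ψ x) := by
  refine ⟨contDiff_id.mul h.contDiff_deriv, ⟨0, fun x hx => ?_⟩, ⟨0, fun x hx => ?_⟩⟩
  · rw [h.deriv_right hx, mul_zero]
  · rw [h.deriv_left hx, mul_zero]

lemma exists_bound (h : IsTailConst ψ) : ∃ C, 0 ≤ C ∧ ∀ x, |ψ x| ≤ C := by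
  obtain ⟨c, hc⟩ := h.right
  obtain ⟨d, hd⟩ := h.left
  obtain ⟨M, hM⟩ := (isCompact_Icc (a := (-1 : ℝ)) (b := 1)).exists_bound_of_continuousOn
    h.continuous.continuousOn
  refine ⟨max M (max |c| |d|), le_trans (abs_nonneg c) (le_max_of_le_right (le_max_left _ _)),
    fun x => ?_⟩
  rcases lt_or_ge 1 x with h1 | h1
  · rw [hc x h1]; exact le_max_of_le_right (le_max_left _ _)
  rcases lt_or_ge x (-1) with h2 | h2
  · rw [hd x h2]; exact le_max_of_le_right (le_max_right _ _)
  · exact le_max_of_le_left (hM x ⟨h2, h1⟩)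

end IsTailConst

/-! ### The parametric integrals `∫_ρ^1 ψ(Y/s) s^{-k} ds` -/

/-- `∫_ρ^1 ψ(Y/s) s^{-k} ds`. -/
noncomputable def scaleIntegral (ψ : ℝ → ℝ) (k : ℕ) (Y ρ : ℝ) : ℝ :=
  ∫ s in ρ..1, ψ (Y / s) * (s⁻¹) ^ k

section scaleIntegral

variable {ψ : ℝ → ℝ} {k : ℕ}

lemma continuousOn_scaleIntegrand (hψ : Continuous ψ) (k : ℕ) (Y : ℝ) :
    ContinuousOn (fun s : ℝ => ψ (Y / s) * (s⁻¹) ^ k) (Set.Ioi 0) := by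
  have h0 : ContinuousOn (fun s : ℝ => s⁻¹) (Set.Ioi 0) :=
    continuousOn_inv₀.mono fun _ hx => (ne_of_gt hx)
  exact (hψ.comp_continuousOn (continuousOn_const.mul h0)).mul (h0.pow k)

lemma uIcc_subset_Ioi {ρ : ℝ} (hρ : 0 < ρ) : Set.uIcc ρ 1 ⊆ Set.Ioi 0 := fun _ hx =>
  lt_of_lt_of_le (lt_min hρ one_pos) hx.1

lemma intervalIntegrable_scaleIntegrand (hψ : Continuous ψ) (k : ℕ) (Y : ℝ) {ρ : ℝ} (hρ : 0 < ρ) :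
    IntervalIntegrable (fun s : ℝ => ψ (Y / s) * (s⁻¹) ^ k) MeasureTheory.volume ρ 1 :=
  ((continuousOn_scaleIntegrand hψ k Y).mono (uIcc_subset_Ioi hρ)).intervalIntegrable

lemma hasDerivAt_scaleIntegral_right (hψ : Continuous ψ) (Y : ℝ) {ρ : ℝ} (hρ : 0 < ρ) :
    HasDerivAt (fun ρ => scaleIntegral ψ k Y ρ) (-(ψ (Y / ρ) * (ρ⁻¹) ^ k)) ρ := by
  have hc := continuousOn_scaleIntegrand hψ k Y
  refine intervalIntegral.integral_hasDerivAt_left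
    (intervalIntegrable_scaleIntegrand hψ k Y hρ) ?_ (hc.continuousAt (Ioi_mem_nhds hρ))
  exact hc.stronglyMeasurableAtFilter isOpen_Ioi _ hρ

/-- Differentiation under the integral sign, legitimate because s stays between ρ and 1, away from
0. A derivative in Y passes from (ψ, k) to (ψ', k + 1), so the family of integrals is closed under
it. -/
lemma hasDerivAt_scaleIntegral_left (h : IsTailConst ψ) (Y : ℝ) {ρ : ℝ} (hρ : 0 < ρ) :
    HasDerivAt (fun Y => scaleIntegral ψ k Y ρ) (scaleIntegral (deriv ψ) (k + 1) Y ρ) Y := by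
  obtain ⟨C, -, hC⟩ := h.deriv.exists_bound
  have hmeas : ∀ {χ : ℝ → ℝ} (_ : Continuous χ) (j : ℕ) (Z : ℝ),
      MeasureTheory.AEStronglyMeasurable (fun s : ℝ => χ (Z / s) * (s⁻¹) ^ j)
        (MeasureTheory.volume.restrict (Set.uIoc ρ 1)) := fun hχ j Z =>
    (intervalIntegrable_scaleIntegrand hχ j Z hρ).def'.aestronglyMeasurable
  -- The dominating function is written as the integrand attached to the constant function C, so
  -- that its integrability is another instance of the same lemma.
  refine (intervalIntegral.hasDerivAt_integral_of_dominated_loc_of_deriv_le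
    (F := fun Y s => ψ (Y / s) * (s⁻¹) ^ k) (F' := fun Y s => deriv ψ (Y / s) * (s⁻¹) ^ (k + 1))
    (bound := fun s => (fun _ => C) (Y / s) * (s⁻¹) ^ (k + 1)) univ_mem
    (Eventually.of_forall fun Z => hmeas h.continuous k Z)
    (intervalIntegrable_scaleIntegrand h.continuous k Y hρ)
    (hmeas h.deriv.continuous (k + 1) Y) ?_
    (intervalIntegrable_scaleIntegrand continuous_const (k + 1) Y hρ) ?_).2
  · refine Eventually.of_forall fun s hs Z _ => ?_
    have : 0 < s := uIcc_subset_Ioi hρ (Set.uIoc_subset_uIcc hs)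
    rw [Real.norm_eq_abs, abs_mul, abs_of_pos (pow_pos (inv_pos.2 this) _)]
    exact mul_le_mul_of_nonneg_right (hC _) (by positivity)
  · refine Eventually.of_forall fun s _ Z _ => ?_
    have h1 : HasDerivAt (fun x : ℝ => x / s) (1 / s) Z := (hasDerivAt_id Z).div_const s
    have := ((h.hasDerivAt (Z / s)).comp Z h1).mul_const ((s⁻¹) ^ k)
    refine this.congr_deriv ?_
    rw [pow_succ, one_div]; ring

/-- Replacing s by max(s, c), with 0 < c < min(u.2, 1), makes the integrand jointly continuous on
the whole plane without changing the integral near u. -/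
lemma continuousAt_scaleIntegral (hψ : Continuous ψ) (u : ℝ × ℝ) (hu : 0 < u.2) :
    ContinuousAt (Function.uncurry (scaleIntegral ψ k)) u := by
  obtain ⟨c, hc0, hcu⟩ := exists_between (lt_min hu one_pos)
  have hpos : ∀ s : ℝ, 0 < max s c := fun s => lt_max_of_lt_right hc0
  have hcont : Continuous (Function.uncurry fun (Y s : ℝ) =>
      ψ (Y / max s c) * ((max s c)⁻¹) ^ k) := by
    have hi : Continuous fun q : ℝ × ℝ => (max q.2 c)⁻¹ :=
      (continuous_snd.max continuous_const).inv₀ fun q => (hpos q.2).ne'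
    exact (hψ.comp (continuous_fst.mul hi)).mul (hi.pow k)
  have := (intervalIntegral.continuous_parametric_primitive_of_continuous
    (μ := MeasureTheory.volume) (a₀ := 1) hcont).neg
  refine (this.continuousAt (x := u)).congr ?_
  have hev : ∀ᶠ v : ℝ × ℝ in 𝓝 u, c < v.2 :=
    continuous_snd.continuousAt.eventually (lt_mem_nhds (hcu.trans_le (min_le_left _ _)))
  filter_upwards [hev] with v hv
  change -(∫ s in (1 : ℝ)..v.2, ψ (v.1 / max s c) * ((max s c)⁻¹) ^ k) = scaleIntegral ψ k v.1 v.2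
  rw [← intervalIntegral.integral_symm]
  refine intervalIntegral.integral_congr fun s hs => ?_
  have : c ≤ s := (le_min hv.le (hcu.trans_le (min_le_right _ _)).le).trans hs.1
  simp only [max_eq_left this]

lemma hasFDerivAt_scaleIntegral (h : IsTailConst ψ) (u : ℝ × ℝ) (hu : 0 < u.2) :
    HasFDerivAt (Function.uncurry (scaleIntegral ψ k))
      (scaleIntegral (deriv ψ) (k + 1) u.1 u.2 • ContinuousLinearMap.fst ℝ ℝ ℝ
        + (-(ψ (u.1 / u.2) * (u.2⁻¹) ^ k)) • ContinuousLinearMap.snd ℝ ℝ ℝ) u := by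
  have hev : ∀ᶠ v : ℝ × ℝ in 𝓝 u, 0 < v.2 :=
    continuous_snd.continuousAt.eventually (lt_mem_nhds hu)
  have key := hasStrictFDerivAt_uncurry_coprod (𝕜 := ℝ) (u := u) (f := scaleIntegral ψ k)
    (f₁ := fun Y ρ => ContinuousLinearMap.toSpanSingleton ℝ (scaleIntegral (deriv ψ) (k + 1) Y ρ))
    (f₂ := fun Y ρ => ContinuousLinearMap.toSpanSingleton ℝ (-(ψ (Y / ρ) * (ρ⁻¹) ^ k)))
    (hev.mono fun v hv => (hasDerivAt_scaleIntegral_left h v.1 hv).hasFDerivAt)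
    (hev.mono fun v hv => (hasDerivAt_scaleIntegral_right h.continuous v.1 hv).hasFDerivAt)
    ((ContinuousLinearMap.toSpanSingletonCLE (𝕜 := ℝ) (E := ℝ)).continuous.continuousAt.comp
      (continuousAt_scaleIntegral h.deriv.continuous u hu)) ?_
  · refine key.hasFDerivAt.congr_fderiv ?_
    ext <;> simp [Function.HasUncurry.uncurry]
  · refine (ContinuousLinearMap.toSpanSingletonCLE (𝕜 := ℝ) (E := ℝ)).continuous.continuousAt.comp
      (f := fun q : ℝ × ℝ => -(ψ (q.1 / q.2) * (q.2⁻¹) ^ k)) ?_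
    have h2 : ContinuousAt (fun q : ℝ × ℝ => q.2⁻¹) u := continuous_snd.continuousAt.inv₀ hu.ne'
    have h3 : ContinuousAt (fun q : ℝ × ℝ => q.1 / q.2) u := continuous_fst.continuousAt.mul h2
    exact ((h.continuous.continuousAt.comp h3).mul (h2.pow k)).neg

/-- Induction on the order of differentiability, for all ψ and k at once: the gradient consists of
the integral for (ψ', k + 1) and the elementary function ψ(Y/ρ) ρ^{-k}. -/
lemma contDiffOn_scaleIntegral (h : IsTailConst ψ) :
    ContDiffOn ℝ ∞ (Function.uncurry (scaleIntegral ψ k)) {u | 0 < u.2} := by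
  have hopen : IsOpen {u : ℝ × ℝ | 0 < u.2} := isOpen_lt continuous_const continuous_snd
  rw [contDiffOn_infty]
  intro m
  induction m generalizing ψ k with
  | zero =>
    exact contDiffOn_zero.2 fun u hu =>
      (continuousAt_scaleIntegral h.continuous u hu).continuousWithinAt
  | succ m ih =>
    have hcast : ((m + 1 : ℕ) : WithTop ℕ∞) = (m : WithTop ℕ∞) + 1 := by norm_cast
    rw [hcast, contDiffOn_succ_iff_fderiv_of_isOpen hopen]
    refine ⟨fun u hu => (hasFDerivAt_scaleIntegral h u hu).differentiableAt.differentiableWithinAt,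
      by simp, ?_⟩
    refine ContDiffOn.congr ?_ fun u hu => (hasFDerivAt_scaleIntegral h u hu).fderiv
    have hi : ContDiffOn ℝ m (fun q : ℝ × ℝ => q.2⁻¹) {u : ℝ × ℝ | 0 < u.2} :=
      contDiffOn_snd.inv fun q hq => (ne_of_gt hq)
    have hq : ContDiffOn ℝ m (fun q : ℝ × ℝ => q.1 / q.2) {u : ℝ × ℝ | 0 < u.2} :=
      contDiffOn_fst.mul hi
    have hs : ContDiff ℝ m ψ := h.smooth.of_le (by exact_mod_cast le_top)
    exact ((ih (k := k + 1) h.deriv).smul contDiffOn_const).add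
      (((hs.comp_contDiffOn hq).mul (hi.pow k)).neg.smul contDiffOn_const)

lemma abs_scaleIntegral_le {C : ℝ} (hC : ∀ x, |ψ x| ≤ C) (Y : ℝ) {ρ : ℝ} (hρ : 0 < ρ)
    (hρ1 : ρ ≤ 1) :
    |scaleIntegral ψ k Y ρ| ≤ C * ∫ s in ρ..1, (s⁻¹) ^ k := by
  rw [← intervalIntegral.integral_const_mul, ← Real.norm_eq_abs]
  refine intervalIntegral.norm_integral_le_of_norm_le (μ := MeasureTheory.volume) hρ1
    (Eventually.of_forall fun s hs => ?_)
    (intervalIntegrable_scaleIntegrand (ψ := fun _ => C) continuous_const k Y hρ)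
  have : 0 < s := hρ.trans hs.1
  rw [Real.norm_eq_abs, abs_mul, abs_of_pos (pow_pos (inv_pos.2 this) _)]
  exact mul_le_mul_of_nonneg_right (hC _) (by positivity)

lemma integral_inv_pow_one {ρ : ℝ} (hρ : 0 < ρ) : ∫ s in ρ..1, (s⁻¹) ^ 1 = -Real.log ρ := by
  simp only [pow_one]
  rw [integral_inv_of_pos hρ one_pos, one_div, Real.log_inv]

lemma integral_inv_pow_succ_le (k : ℕ) {ρ : ℝ} (hρ : 0 < ρ) (hρ1 : ρ ≤ 1) :
    ∫ s in ρ..1, (s⁻¹) ^ (k + 2) ≤ (ρ⁻¹) ^ (k + 1) := by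
  have hd : ∀ s ∈ Set.uIcc ρ 1, HasDerivAt (fun s : ℝ => -(s⁻¹) ^ (k + 1))
      ((k + 1) * (s⁻¹) ^ (k + 2)) s := fun s hs => by
    have h0 : s ≠ 0 := (ne_of_gt (uIcc_subset_Ioi hρ hs))
    have := ((hasDerivAt_inv h0).pow (k + 1)).neg
    refine this.congr_deriv ?_
    have : s⁻¹ ^ (k + 2) = s⁻¹ ^ k * (s ^ 2)⁻¹ := by rw [pow_add, inv_pow s 2]
    rw [this, Nat.add_sub_cancel]
    push_cast
    ring
  have hint := intervalIntegrable_scaleIntegrand (ψ := fun _ => (k + 1 : ℝ)) continuous_const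
    (k + 2) 0 hρ
  have := intervalIntegral.integral_eq_sub_of_hasDerivAt hd hint
  rw [intervalIntegral.integral_const_mul] at this
  have hnn : 0 ≤ ∫ s in ρ..1, (s⁻¹) ^ (k + 2) :=
    intervalIntegral.integral_nonneg hρ1 fun s hs => by
      have : 0 < s := hρ.trans_le hs.1
      positivity
  have hk : (0 : ℝ) ≤ k := k.cast_nonneg
  simp only [inv_one, one_pow] at this
  -- The primitive gives (k + 1)∫ = ρ^{-(k+1)} - 1, and ∫ ≤ (k + 1)∫ because the integral is
  -- nonnegative.
  nlinarith

end scaleIntegral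

variable {n : ℕ}

lemma isOpen_openCollar (n : ℕ) (a : ℝ) : IsOpen (openCollar n a) :=
  (isOpen_lt continuous_const (continuous_apply 0)).inter
    (isOpen_lt (continuous_apply 0) continuous_const)

/-! ### Functions of order `ρ^{-q}` and symbols -/

/-- `F = O(ρ^{-q})`, uniformly on the collar. -/
def IsOrder (q : ℝ) (F : Coord n → ℝ) : Prop :=
  ∃ C, ∀ x ∈ openCollar n 1, |F x| ≤ C * x 0 ^ (-q)

namespace IsOrder

variable {q q' : ℝ} {F G : Coord n → ℝ}

lemma exists_nonneg (h : IsOrder q F) :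
    ∃ C, 0 ≤ C ∧ ∀ x ∈ openCollar n 1, |F x| ≤ C * x 0 ^ (-q) := by
  obtain ⟨C, hC⟩ := h
  refine ⟨|C|, abs_nonneg C, fun x hx => (hC x hx).trans ?_⟩
  exact mul_le_mul_of_nonneg_right (le_abs_self C) (Real.rpow_nonneg hx.1.le _)

lemma mono (h : IsOrder q F) (hq : q ≤ q') : IsOrder q' F := by
  obtain ⟨C, h0, hC⟩ := h.exists_nonneg
  refine ⟨C, fun x hx => (hC x hx).trans (mul_le_mul_of_nonneg_left ?_ h0)⟩
  exact Real.rpow_le_rpow_of_exponent_ge hx.1 hx.2.le (by linarith)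

lemma congr (h : IsOrder q F) (e : ∀ x ∈ openCollar n 1, G x = F x) : IsOrder q G := by
  obtain ⟨C, hC⟩ := h
  exact ⟨C, fun x hx => by rw [e x hx]; exact hC x hx⟩

lemma add (h : IsOrder q F) (h' : IsOrder q G) : IsOrder q (fun x => F x + G x) := by
  obtain ⟨C, hC⟩ := h
  obtain ⟨C', hC'⟩ := h'
  refine ⟨C + C', fun x hx => (abs_add_le _ _).trans ?_⟩
  rw [add_mul]
  exact add_le_add (hC x hx) (hC' x hx)

lemma neg (h : IsOrder q F) : IsOrder q (fun x => -F x) := by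
  obtain ⟨C, hC⟩ := h
  exact ⟨C, fun x hx => by rw [abs_neg]; exact hC x hx⟩

lemma sub (h : IsOrder q F) (h' : IsOrder q G) : IsOrder q (fun x => F x - G x) := by
  simpa only [sub_eq_add_neg] using h.add h'.neg

lemma mul (h : IsOrder q F) (h' : IsOrder q' G) : IsOrder (q + q') (fun x => F x * G x) := by
  obtain ⟨C, h0, hC⟩ := h.exists_nonneg
  obtain ⟨C', h0', hC'⟩ := h'.exists_nonneg
  refine ⟨C * C', fun x hx => ?_⟩
  rw [abs_mul, neg_add, Real.rpow_add hx.1]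
  calc |F x| * |G x| ≤ (C * x 0 ^ (-q)) * (C' * x 0 ^ (-q')) :=
        mul_le_mul (hC x hx) (hC' x hx) (abs_nonneg _)
          (mul_nonneg h0 (Real.rpow_nonneg hx.1.le _))
    _ = _ := by ring

lemma const (c : ℝ) : IsOrder 0 (fun _ : Coord n => c) :=
  ⟨|c|, fun x _ => by simp⟩

lemma of_bound {C : ℝ} (h : ∀ x ∈ openCollar n 1, |F x| ≤ C) : IsOrder 0 F :=
  ⟨C, fun x hx => by simpa using h x hx⟩

lemma const_mul (h : IsOrder q F) (c : ℝ) : IsOrder q (fun x => c * F x) := by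
  simpa using (const c).mul h

lemma sum {ι : Type*} (s : Finset ι) {F : ι → Coord n → ℝ} (h : ∀ i ∈ s, IsOrder q (F i)) :
    IsOrder q (fun x => ∑ i ∈ s, F i x) := by
  classical
  induction s using Finset.induction_on with
  | empty => exact ⟨0, fun x _ => by simp⟩
  | insert i s hi ih =>
    simp only [Finset.sum_insert hi]
    exact (h i (Finset.mem_insert_self i s)).add
      (ih fun j hj => h j (Finset.mem_insert_of_mem hj))

end IsOrder

lemma pd_congr {F G : Coord n → ℝ} (e : ∀ x ∈ openCollar n 1, F x = G x) {x : Coord n}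
    (hx : x ∈ openCollar n 1) (m : Fin (n + 1)) : pd m F x = pd m G x := by
  have : F =ᶠ[𝓝 x] G := by
    filter_upwards [(isOpen_openCollar n 1).mem_nhds hx] with z hz using e z hz
  rw [pd, pd, this.fderiv_eq]

lemma pd_add {F G : Coord n → ℝ} {x : Coord n} (hF : DifferentiableAt ℝ F x)
    (hG : DifferentiableAt ℝ G x) (m : Fin (n + 1)) :
    pd m (fun z => F z + G z) x = pd m F x + pd m G x := by
  simp only [pd]
  rw [fderiv_fun_add hF hG]; rfl

lemma pd_sub {F G : Coord n → ℝ} {x : Coord n} (hF : DifferentiableAt ℝ F x)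
    (hG : DifferentiableAt ℝ G x) (m : Fin (n + 1)) :
    pd m (fun z => F z - G z) x = pd m F x - pd m G x := by
  simp only [pd]
  rw [fderiv_fun_sub hF hG]; rfl

lemma pd_mul {F G : Coord n → ℝ} {x : Coord n} (hF : DifferentiableAt ℝ F x)
    (hG : DifferentiableAt ℝ G x) (m : Fin (n + 1)) :
    pd m (fun z => F z * G z) x = F x * pd m G x + pd m F x * G x := by
  simp only [pd]
  rw [fderiv_fun_mul hF hG]
  simp [mul_comm]

/-- Differentiable functions with `F = O(ρ^{-q})` and `∂F = O(ρ^{-q-1})`. -/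
structure IsSymbol (q : ℝ) (F : Coord n → ℝ) : Prop where
  differentiableAt : ∀ x ∈ openCollar n 1, DifferentiableAt ℝ F x
  order : IsOrder q F
  pd_order : ∀ m, IsOrder (q + 1) (pd m F)

namespace IsSymbol

variable {q q' : ℝ} {F G : Coord n → ℝ}

lemma mono (h : IsSymbol q F) (hq : q ≤ q') : IsSymbol q' F :=
  ⟨h.1, h.2.mono hq, fun m => (h.3 m).mono (by linarith)⟩

lemma add (h : IsSymbol q F) (h' : IsSymbol q G) : IsSymbol q (fun x => F x + G x) :=
  ⟨fun x hx => (h.1 x hx).add (h'.1 x hx), h.2.add h'.2,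
    fun m => ((h.3 m).add (h'.3 m)).congr fun x hx => pd_add (h.1 x hx) (h'.1 x hx) m⟩

lemma mul (h : IsSymbol q F) (h' : IsSymbol q' G) : IsSymbol (q + q') (fun x => F x * G x) := by
  refine ⟨fun x hx => (h.1 x hx).mul (h'.1 x hx), h.2.mul h'.2, fun m => ?_⟩
  refine IsOrder.congr ?_ fun x hx => pd_mul (h.1 x hx) (h'.1 x hx) m
  exact ((h.2.mul (h'.3 m)).mono (by linarith)).add (((h.3 m).mul h'.2).mono (by linarith))

lemma const (c : ℝ) : IsSymbol 0 (fun _ : Coord n => c) := by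
  refine ⟨fun x _ => differentiableAt_const c, .const c, fun m => ?_⟩
  refine ((IsOrder.const 0).mono (by norm_num)).congr fun x _ => ?_
  simp [pd]

lemma const_mul (h : IsSymbol q F) (c : ℝ) : IsSymbol q (fun x => c * F x) := by
  simpa using (const c).mul h

lemma neg (h : IsSymbol q F) : IsSymbol q (fun x => -F x) := by
  simpa using h.const_mul (-1)

lemma sub (h : IsSymbol q F) (h' : IsSymbol q G) : IsSymbol q (fun x => F x - G x) := by
  simpa only [sub_eq_add_neg] using h.add h'.neg

end IsSymbol

/-! ### Functions of `ρ` and of one tangential coordinate -/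

/-- On the collar, `dF = F₀ dx⁰ + F₁ dx^p`. -/
def HasGrad (p : Fin (n + 1)) (F F₀ F₁ : Coord n → ℝ) : Prop :=
  ∀ x ∈ openCollar n 1, HasFDerivAt F
    (F₀ x • ContinuousLinearMap.proj (R := ℝ) (φ := fun _ : Fin (n + 1) => ℝ) 0
      + F₁ x • ContinuousLinearMap.proj (R := ℝ) (φ := fun _ : Fin (n + 1) => ℝ) p) x

/-- The Kronecker delta. -/
def kron (i j : Fin (n + 1)) : ℝ := if i = j then 1 else 0

namespace HasGrad

variable {p : Fin (n + 1)} {F F₀ F₁ G G₀ G₁ : Coord n → ℝ}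

lemma differentiableAt (h : HasGrad p F F₀ F₁) {x : Coord n} (hx : x ∈ openCollar n 1) :
    DifferentiableAt ℝ F x := (h x hx).differentiableAt

lemma pd_eq (h : HasGrad p F F₀ F₁) {x : Coord n} (hx : x ∈ openCollar n 1) (m : Fin (n + 1)) :
    pd m F x = kron m 0 * F₀ x + kron m p * F₁ x := by
  rw [pd, (h x hx).fderiv]
  simp [Pi.single_apply, kron, eq_comm]

lemma congr_grad (h : HasGrad p F F₀ F₁) (h₀ : ∀ x ∈ openCollar n 1, G₀ x = F₀ x)
    (h₁ : ∀ x ∈ openCollar n 1, G₁ x = F₁ x) : HasGrad p F G₀ G₁ := fun x hx => by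
  rw [h₀ x hx, h₁ x hx]; exact h x hx

lemma add (h : HasGrad p F F₀ F₁) (h' : HasGrad p G G₀ G₁) :
    HasGrad p (fun x => F x + G x) (fun x => F₀ x + G₀ x) (fun x => F₁ x + G₁ x) := fun x hx => by
  refine ((h x hx).add (h' x hx)).congr_fderiv ?_
  module

lemma mul (h : HasGrad p F F₀ F₁) (h' : HasGrad p G G₀ G₁) :
    HasGrad p (fun x => F x * G x) (fun x => F₀ x * G x + F x * G₀ x)
      (fun x => F₁ x * G x + F x * G₁ x) := fun x hx => by
  refine ((h x hx).mul (h' x hx)).congr_fderiv ?_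
  module

lemma const (c : ℝ) : HasGrad p (fun _ => c) (fun _ => 0) (fun _ => 0) := fun x _ => by
  simpa using hasFDerivAt_const c x

lemma const_mul (h : HasGrad p F F₀ F₁) (c : ℝ) :
    HasGrad p (fun x => c * F x) (fun x => c * F₀ x) (fun x => c * F₁ x) := by
  simpa using (const c).mul h

lemma neg (h : HasGrad p F F₀ F₁) :
    HasGrad p (fun x => -F x) (fun x => -F₀ x) (fun x => -F₁ x) := by
  simpa using h.const_mul (-1)

lemma sub (h : HasGrad p F F₀ F₁) (h' : HasGrad p G G₀ G₁) :
    HasGrad p (fun x => F x - G x) (fun x => F₀ x - G₀ x) (fun x => F₁ x - G₁ x) := by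
  simpa only [sub_eq_add_neg] using h.add h'.neg

lemma comp {ψ : ℝ → ℝ} {ψ' : Coord n → ℝ} (h : HasGrad p F F₀ F₁)
    (hψ : ∀ x ∈ openCollar n 1, HasDerivAt ψ (ψ' x) (F x)) :
    HasGrad p (fun x => ψ (F x)) (fun x => ψ' x * F₀ x) (fun x => ψ' x * F₁ x) := fun x hx => by
  refine ((hψ x hx).comp_hasFDerivAt x (h x hx)).congr_fderiv ?_
  module

lemma isSymbol {q : ℝ} (h : HasGrad p F F₀ F₁) (hF : IsOrder q F) (h₀ : IsOrder (q + 1) F₀)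
    (h₁ : IsOrder (q + 1) F₁) : IsSymbol q F :=
  ⟨fun _ hx => h.differentiableAt hx, hF, fun m =>
    ((h₀.const_mul _).add (h₁.const_mul _)).congr fun _ hx => h.pd_eq hx m⟩

end HasGrad

/-! ### The building blocks of the metric -/

section blocks

/-- `1/ρ`. -/
noncomputable def invRho (x : Coord n) : ℝ := (x 0)⁻¹

/-- `ψ(sin y / ρ)`, where `y = x^p`. -/
noncomputable def tailFn (ψ : ℝ → ℝ) (p : Fin (n + 1)) (x : Coord n) : ℝ := ψ (Real.sin (x p) / x 0)

/-- `∫_ρ^1 ψ(sin y / s) s^{-k} ds`, where `y = x^p`. -/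
noncomputable def scaleFn (ψ : ℝ → ℝ) (k : ℕ) (p : Fin (n + 1)) (x : Coord n) : ℝ :=
  scaleIntegral ψ k (Real.sin (x p)) (x 0)

variable {p : Fin (n + 1)} {ψ : ℝ → ℝ}

lemma hasGrad_coord (p : Fin (n + 1)) : HasGrad p (fun x => x p) (fun _ => 0) (fun _ => 1) :=
  fun x _ => (hasFDerivAt_apply p x).congr_fderiv (by simp)

lemma hasGrad_rho (p : Fin (n + 1)) : HasGrad p (fun x => x 0) (fun _ => 1) (fun _ => 0) :=
  fun x _ => (hasFDerivAt_apply 0 x).congr_fderiv (by simp)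

lemma hasGrad_sin (p : Fin (n + 1)) :
    HasGrad p (fun x => Real.sin (x p)) (fun _ => 0) (fun x => Real.cos (x p)) := by
  simpa using (hasGrad_coord p).comp fun x _ => Real.hasDerivAt_sin (x p)

lemma hasGrad_cos (p : Fin (n + 1)) :
    HasGrad p (fun x => Real.cos (x p)) (fun _ => 0) (fun x => -Real.sin (x p)) := by
  simpa using (hasGrad_coord p).comp fun x _ => Real.hasDerivAt_cos (x p)

lemma hasGrad_invRho (p : Fin (n + 1)) :
    HasGrad p invRho (fun x => -(invRho x * invRho x)) (fun _ => 0) := by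
  refine ((hasGrad_rho p).comp fun x hx => hasDerivAt_inv hx.1.ne').congr_grad
    (fun x hx => ?_) (fun x _ => by simp)
  simp [invRho, sq]

lemma hasGrad_tailFn (h : IsTailConst ψ) (p : Fin (n + 1)) :
    HasGrad p (tailFn ψ p) (fun x => -(tailFn (fun t => t * deriv ψ t) p x * invRho x))
      (fun x => tailFn (deriv ψ) p x * (Real.cos (x p) * invRho x)) := by
  have h1 : HasGrad p (fun x => Real.sin (x p) / x 0) _ _ := (hasGrad_sin p).mul (hasGrad_invRho p)
  refine (h1.comp fun x _ => h.hasDerivAt _).congr_grad (fun x hx => ?_) (fun x _ => ?_)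
  · simp only [tailFn, invRho]; field_simp; ring
  · simp only [tailFn, invRho]; ring

lemma hasGrad_scaleFn (h : IsTailConst ψ) (k : ℕ) (p : Fin (n + 1)) :
    HasGrad p (scaleFn ψ k p) (fun x => -(tailFn ψ p x * invRho x ^ k))
      (fun x => scaleFn (deriv ψ) (k + 1) p x * Real.cos (x p)) := fun x hx => by
  have h1 := (hasGrad_sin p x hx).prodMk (hasGrad_rho p x hx)
  refine ((hasFDerivAt_scaleIntegral (k := k) h (Real.sin (x p), x 0) hx.1).comp
    (f := fun x : Coord n => (Real.sin (x p), x 0)) x h1).congr_fderiv ?_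
  ext v
  simp [tailFn, scaleFn, invRho]
  ring

lemma isOrder_invRho : IsOrder 1 (invRho : Coord n → ℝ) :=
  ⟨1, fun x hx => by
    rw [invRho, abs_of_pos (inv_pos.2 hx.1), one_mul, Real.rpow_neg_one]⟩

lemma isOrder_invRho_pow (k : ℕ) : IsOrder (k : ℝ) (fun x : Coord n => invRho x ^ k) :=
  ⟨1, fun x hx => by
    simp only [invRho]
    rw [abs_of_pos (pow_pos (inv_pos.2 hx.1) _), one_mul, Real.rpow_neg hx.1.le,
      Real.rpow_natCast, inv_pow]⟩

lemma isOrder_sin (p : Fin (n + 1)) : IsOrder 0 (fun x : Coord n => Real.sin (x p)) :=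
  .of_bound fun _ _ => Real.abs_sin_le_one _

lemma isOrder_cos (p : Fin (n + 1)) : IsOrder 0 (fun x : Coord n => Real.cos (x p)) :=
  .of_bound fun _ _ => Real.abs_cos_le_one _

lemma isOrder_tailFn (h : IsTailConst ψ) (p : Fin (n + 1)) : IsOrder 0 (tailFn ψ p) :=
  let ⟨_, _, hC⟩ := h.exists_bound
  .of_bound fun _ _ => hC _

lemma isOrder_scaleFn_succ (h : IsTailConst ψ) (k : ℕ) (p : Fin (n + 1)) :
    IsOrder ((k + 1 : ℕ) : ℝ) (scaleFn ψ (k + 2) p) := by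
  obtain ⟨C, h0, hC⟩ := h.exists_bound
  refine ⟨C, fun x hx => (abs_scaleIntegral_le hC _ hx.1 hx.2.le).trans ?_⟩
  refine (mul_le_mul_of_nonneg_left (integral_inv_pow_succ_le k hx.1 hx.2.le) h0).trans_eq ?_
  rw [Real.rpow_neg hx.1.le, Real.rpow_natCast, inv_pow]

/-- The true size is log(1/ρ), which is not a power. The exponent 1/2 is the largest whose square is
still O(1/ρ), as needed for the term b² in the curvature. -/
lemma isOrder_scaleFn_one (h : IsTailConst ψ) (p : Fin (n + 1)) :
    IsOrder (1 / 2) (scaleFn ψ 1 p) := by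
  obtain ⟨C, h0, hC⟩ := h.exists_bound
  refine ⟨C * 2, fun x hx => (abs_scaleIntegral_le hC _ hx.1 hx.2.le).trans ?_⟩
  rw [integral_inv_pow_one hx.1, mul_assoc]
  refine mul_le_mul_of_nonneg_left ?_ h0
  have := Real.log_le_rpow_div (inv_pos.2 hx.1).le (by norm_num : (0 : ℝ) < 1 / 2)
  rw [Real.log_inv, Real.inv_rpow hx.1.le, ← Real.rpow_neg hx.1.le] at this
  linarith

lemma isSymbol_invRho : IsSymbol 1 (invRho : Coord n → ℝ) :=
  (hasGrad_invRho 0).isSymbol isOrder_invRho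
    ((isOrder_invRho.mul isOrder_invRho).neg) ((IsOrder.const 0).mono (by norm_num))

lemma isSymbol_sin (p : Fin (n + 1)) : IsSymbol 0 (fun x : Coord n => Real.sin (x p)) :=
  (hasGrad_sin p).isSymbol (isOrder_sin p) ((IsOrder.const 0).mono (by norm_num))
    ((isOrder_cos p).mono (by norm_num))

lemma isSymbol_cos (p : Fin (n + 1)) : IsSymbol 0 (fun x : Coord n => Real.cos (x p)) :=
  (hasGrad_cos p).isSymbol (isOrder_cos p) ((IsOrder.const 0).mono (by norm_num))
    ((isOrder_sin p).neg.mono (by norm_num))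

lemma isSymbol_tailFn (h : IsTailConst ψ) (p : Fin (n + 1)) : IsSymbol 0 (tailFn ψ p) :=
  (hasGrad_tailFn h p).isSymbol (isOrder_tailFn h p)
    ((isOrder_tailFn h.id_mul_deriv p).mul isOrder_invRho).neg
    (((isOrder_tailFn h.deriv p).mul ((isOrder_cos p).mul isOrder_invRho)).mono (by norm_num))

lemma isSymbol_scaleFn_succ (h : IsTailConst ψ) (k : ℕ) (p : Fin (n + 1)) :
    IsSymbol ((k + 1 : ℕ) : ℝ) (scaleFn ψ (k + 2) p) :=
  (hasGrad_scaleFn h _ p).isSymbol (isOrder_scaleFn_succ h k p)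
    (((isOrder_tailFn h p).mul (isOrder_invRho_pow (k + 2))).neg.mono (by push_cast; linarith))
    (((isOrder_scaleFn_succ h.deriv (k + 1) p).mul (isOrder_cos p)).mono (by push_cast; linarith))

lemma isSymbol_scaleFn_one (h : IsTailConst ψ) (p : Fin (n + 1)) :
    IsSymbol (1 / 2) (scaleFn ψ 1 p) :=
  (hasGrad_scaleFn h _ p).isSymbol (isOrder_scaleFn_one h p)
    (((isOrder_tailFn h p).mul (isOrder_invRho_pow 1)).neg.mono (by norm_num))
    (((isOrder_scaleFn_succ h.deriv 0 p).mul (isOrder_cos p)).mono (by norm_num))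

end blocks

/-! ### The derivatives of `f/2` and of `e^f` -/

section warping

variable (η : ℝ → ℝ) (p : Fin (n + 1))

/-- `e^{f(y, ρ)}`. -/
noncomputable def warp (x : Coord n) : ℝ := Real.exp (potential η (x p) (x 0))

/-- `½ ∂_ρ f`. -/
noncomputable def slopeRho (x : Coord n) : ℝ := -tailFn η p x

/-- `½ ∂_y f`. -/
noncomputable def slopeY (x : Coord n) : ℝ := scaleFn (deriv η) 1 p x * Real.cos (x p)

/-- `½ ∂_ρ² f`. -/
noncomputable def hessRho (x : Coord n) : ℝ := tailFn (fun t => t * deriv η t) p x * invRho x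

/-- `½ ∂_ρ ∂_y f`. -/
noncomputable def hessMixed (x : Coord n) : ℝ :=
  -(tailFn (deriv η) p x * (Real.cos (x p) * invRho x))

/-- `½ ∂_y² f`. -/
noncomputable def hessY (x : Coord n) : ℝ :=
  scaleFn (deriv (deriv η)) 2 p x * (Real.cos (x p) * Real.cos (x p))
    - scaleFn (deriv η) 1 p x * Real.sin (x p)

variable {η p}

lemma potential_eq (η : ℝ → ℝ) (y ρ : ℝ) :
    potential η y ρ = 2 * scaleIntegral η 0 (Real.sin y) ρ := by
  simp [potential, scaleIntegral]

lemma hasGrad_potential (h : IsTailConst η) :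
    HasGrad p (fun x => potential η (x p) (x 0)) (fun x => 2 * slopeRho η p x)
      (fun x => 2 * slopeY η p x) := by
  simp only [potential_eq]
  refine ((hasGrad_scaleFn h 0 p).const_mul 2).congr_grad (fun x _ => ?_) (fun x _ => ?_)
  · simp [slopeRho]
  · simp [slopeY]

lemma hasGrad_warp (h : IsTailConst η) :
    HasGrad p (warp η p) (fun x => 2 * slopeRho η p x * warp η p x)
      (fun x => 2 * slopeY η p x * warp η p x) := by
  refine ((hasGrad_potential h).comp fun x _ => Real.hasDerivAt_exp _).congr_grad
    (fun x _ => ?_) (fun x _ => ?_)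
  · rw [mul_comm]; rfl
  · rw [mul_comm]; rfl

lemma hasGrad_slopeRho (h : IsTailConst η) :
    HasGrad p (slopeRho η p) (hessRho η p) (hessMixed η p) :=
  (hasGrad_tailFn h p).neg.congr_grad (fun x _ => by simp [hessRho]) (fun x _ => rfl)

lemma hasGrad_slopeY (h : IsTailConst η) :
    HasGrad p (slopeY η p) (hessMixed η p) (hessY η p) :=
  ((hasGrad_scaleFn h.deriv 1 p).mul (hasGrad_cos p)).congr_grad
    (fun x _ => by simp [hessMixed]; ring) (fun x _ => by simp [hessY]; ring)

lemma abs_potential_le (h : IsCutoff η) (y : ℝ) {ρ : ℝ} (h0 : 0 < ρ) (h1 : ρ < 1) :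
    |potential η y ρ| ≤ 2 := by
  rw [potential_eq, abs_mul, abs_two]
  have := abs_scaleIntegral_le (k := 0) h.abs_le_one (Real.sin y) h0 h1.le
  simp only [pow_zero, intervalIntegral.integral_const, smul_eq_mul, mul_one, one_mul] at this
  linarith

lemma warp_pos (x : Coord n) : 0 < warp η p x := Real.exp_pos _

lemma warp_le (h : IsCutoff η) {x : Coord n} (hx : x ∈ openCollar n 1) :
    warp η p x ≤ Real.exp 2 :=
  Real.exp_le_exp.2 (abs_le.1 (abs_potential_le h _ hx.1 hx.2)).2

lemma le_warp (h : IsCutoff η) {x : Coord n} (hx : x ∈ openCollar n 1) :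
    Real.exp (-2) ≤ warp η p x :=
  Real.exp_le_exp.2 (abs_le.1 (abs_potential_le h _ hx.1 hx.2)).1

lemma isSymbol_slopeRho (h : IsTailConst η) : IsSymbol 0 (slopeRho η p) :=
  (isSymbol_tailFn h p).neg

lemma isSymbol_slopeY (h : IsTailConst η) : IsSymbol (1 / 2) (slopeY η p) :=
  ((isSymbol_scaleFn_one h.deriv p).mul (isSymbol_cos p)).mono (by norm_num)

lemma isSymbol_hessRho (h : IsTailConst η) : IsSymbol 1 (hessRho η p) :=
  ((isSymbol_tailFn h.id_mul_deriv p).mul isSymbol_invRho).mono (by norm_num)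

lemma isSymbol_hessMixed (h : IsTailConst η) : IsSymbol 1 (hessMixed η p) :=
  ((isSymbol_tailFn h.deriv p).mul ((isSymbol_cos p).mul isSymbol_invRho)).neg.mono (by norm_num)

/-- A second y-derivative puts s^{-2} under the integral, which yields 1/ρ; the other term comes
from differentiating cos y and is only logarithmic. -/
lemma isSymbol_hessY (h : IsTailConst η) : IsSymbol 1 (hessY η p) :=
  (((isSymbol_scaleFn_succ h.deriv.deriv 0 p).mul
      ((isSymbol_cos p).mul (isSymbol_cos p))).mono (by norm_num)).sub
    (((isSymbol_scaleFn_one h.deriv p).mul (isSymbol_sin p)).mono (by norm_num))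

lemma isSymbol_warp (h : IsCutoff η) : IsSymbol 0 (warp η p) := by
  have hE : IsOrder 0 (warp η p) := .of_bound (C := Real.exp 2) fun x hx => by
    rw [abs_of_pos (warp_pos x)]; exact warp_le h hx
  have ht := h.isTailConst
  exact (hasGrad_warp ht).isSymbol hE
    ((((isSymbol_slopeRho ht).order.const_mul 2).mul hE).mono (by norm_num))
    ((((isSymbol_slopeY ht).order.const_mul 2).mul hE).mono (by norm_num))

end warping

/-! ### Contractions of coordinate tensors -/

/-- The Kronecker delta on tangential indices. -/
def tang (i j : Fin (n + 1)) : ℝ := if i = j ∧ i ≠ 0 then 1 else 0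

lemma kron_self (i : Fin (n + 1)) : kron i i = 1 := if_pos rfl

lemma kron_of_ne {i j : Fin (n + 1)} (h : i ≠ j) : kron i j = 0 := if_neg h

lemma kron_comm (i j : Fin (n + 1)) : kron i j = kron j i := by simp only [kron, eq_comm]

lemma kron_zero_succ (α : Fin n) : kron 0 α.succ = 0 := kron_of_ne (Fin.succ_ne_zero α).symm

lemma kron_succ_zero (α : Fin n) : kron α.succ 0 = 0 := kron_of_ne (Fin.succ_ne_zero α)

lemma tang_comm (i j : Fin (n + 1)) : tang i j = tang j i := by
  unfold tang
  congr 1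
  exact propext ⟨fun h => ⟨h.1.symm, h.1 ▸ h.2⟩, fun h => ⟨h.1.symm, h.1 ▸ h.2⟩⟩

lemma tang_zero_left (i : Fin (n + 1)) : tang 0 i = 0 := if_neg (by simp)

lemma tang_zero_right (i : Fin (n + 1)) : tang i 0 = 0 := by rw [tang_comm, tang_zero_left]

lemma tang_succ_right (i : Fin (n + 1)) (α : Fin n) : tang i α.succ = kron i α.succ := by
  unfold tang kron
  congr 1
  exact propext ⟨fun h => h.1, fun h => ⟨h, h ▸ Fin.succ_ne_zero α⟩⟩

/-- Splits the identity into its normal and tangential parts, which the metric weights differently.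
All later tensors are written in `kron · 0`, `tang` and `kron · α₀.succ`, so that contractions
reduce to `sum_blocks`. -/
lemma kron_eq (i j : Fin (n + 1)) : kron i j = kron i 0 * kron j 0 + tang i j := by
  rcases Fin.eq_zero_or_eq_succ i with rfl | ⟨α, rfl⟩
  · rw [kron_self, tang_zero_left, kron_comm]; ring
  · rw [kron_succ_zero, tang_comm, tang_succ_right, kron_comm]; ring

lemma sum_kron_mul (i : Fin (n + 1)) (f : Fin (n + 1) → ℝ) : ∑ m, kron m i * f m = f i := by
  simp [kron]

lemma sum_tang_mul (i : Fin (n + 1)) (f : Fin (n + 1) → ℝ) :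
    ∑ m, tang i m * f m = f i - kron i 0 * f 0 := by
  have h : ∀ m, tang i m * f m = kron m i * f m - kron i 0 * (kron m 0 * f m) := fun m => by
    rw [kron_eq m i, tang_comm]; ring
  rw [Finset.sum_congr rfl fun m _ => h m, Finset.sum_sub_distrib, ← Finset.mul_sum,
    sum_kron_mul, sum_kron_mul]

/-- Contraction of two expressions which are linear in the building blocks. -/
lemma sum_blocks (α : Fin n) (i j k l : Fin (n + 1)) (A B C D A' B' C' D' : ℝ) :
    ∑ m, (A * kron m 0 + B * tang j m + C * tang k m + D * kron m α.succ) *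
      (A' * kron m 0 + B' * tang m l + C' * tang i m + D' * kron m α.succ) =
    A * A' + B * (B' * tang j l + C' * tang i j + D' * kron j α.succ)
      + C * (B' * tang k l + C' * tang i k + D' * kron k α.succ)
      + D * (B' * kron l α.succ + C' * kron i α.succ + D') := by
  have h : ∀ f : Fin (n + 1) → ℝ,
      ∑ m, (A * kron m 0 + B * tang j m + C * tang k m + D * kron m α.succ) * f m =
      A * f 0 + B * (f j - kron j 0 * f 0) + C * (f k - kron k 0 * f 0) + D * f α.succ := by
    intro f
    simp only [add_mul, Finset.sum_add_distrib, mul_assoc, ← Finset.mul_sum, sum_kron_mul,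
      sum_tang_mul]
  rw [h]
  simp only [kron_self, tang_zero_left, tang_zero_right, kron_zero_succ, kron_succ_zero,
    tang_succ_right, tang_comm α.succ l]
  ring

/-! ### The metric and its Christoffel symbols -/

variable {η : ℝ → ℝ} {α₀ : Fin n}

lemma gMetric_apply (x : Coord n) (i j : Fin (n + 1)) :
    gMetric η α₀ x i j =
      invRho x * invRho x * (kron i 0 * kron j 0 + tang i j * warp η α₀.succ x) := by
  have h : ((x 0) ^ 2)⁻¹ = invRho x * invRho x := by rw [invRho, sq, mul_inv]
  simp only [gMetric, gBar, Matrix.smul_apply, smul_eq_mul, h, Matrix.diagonal_apply]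
  congr 1
  rcases Fin.eq_zero_or_eq_succ i with rfl | ⟨α, rfl⟩
  · rw [kron_self, tang_zero_left, kron]
    simp [eq_comm]
  · rw [kron_succ_zero, tang_comm, tang_succ_right, kron_comm j α.succ]
    simp [warp, kron, Fin.succ_ne_zero]

lemma gMetric_inv_apply {x : Coord n} (hx : x ∈ openCollar n 1) (i j : Fin (n + 1)) :
    (gMetric η α₀ x)⁻¹ i j =
      x 0 * x 0 * (kron i 0 * kron j 0 + tang i j * (warp η α₀.succ x)⁻¹) := by
  have hE := (warp_pos (η := η) (p := α₀.succ) x).ne'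
  have h : (gMetric η α₀ x)⁻¹ = Matrix.of fun i j =>
      x 0 * x 0 * (kron i 0 * kron j 0 + tang i j * (warp η α₀.succ x)⁻¹) := by
    refine Matrix.inv_eq_right_inv ?_
    ext i j
    simp only [Matrix.mul_apply, Matrix.of_apply, gMetric_apply]
    have := sum_blocks α₀ 0 i i j (invRho x * invRho x * kron i 0)
      (invRho x * invRho x * warp η α₀.succ x) 0 0 (x 0 * x 0 * kron j 0)
      (x 0 * x 0 * (warp η α₀.succ x)⁻¹) 0 0
    rw [Matrix.one_apply, ← kron, kron_eq i j]
    have hr : invRho x * x 0 = 1 := inv_mul_cancel₀ hx.1.ne'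
    have hw : warp η α₀.succ x * (warp η α₀.succ x)⁻¹ = 1 := mul_inv_cancel₀ hE
    refine Eq.trans (Finset.sum_congr rfl fun m _ => ?_) (this.trans ?_)
    · rw [kron_comm m 0]; ring
    · linear_combination (kron i 0 * kron j 0 + tang i j *
        (warp η α₀.succ x * (warp η α₀.succ x)⁻¹)) * (invRho x * x 0 + 1) * hr + tang i j * hw
  rw [h, Matrix.of_apply]

lemma hasGrad_gMetric (h : IsTailConst η) (i j : Fin (n + 1)) :
    HasGrad α₀.succ (fun x => gMetric η α₀ x i j)
      (fun x => 2 * (invRho x * invRho x) * (-(invRho x *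
          (kron i 0 * kron j 0 + tang i j * warp η α₀.succ x))
        + tang i j * (slopeRho η α₀.succ x * warp η α₀.succ x)))
      (fun x => 2 * (invRho x * invRho x) *
        (tang i j * (slopeY η α₀.succ x * warp η α₀.succ x))) := by
  have hr := hasGrad_invRho (n := n) α₀.succ
  have := (hr.mul hr).mul ((HasGrad.const (kron i 0 * kron j 0)).add
    ((hasGrad_warp (p := α₀.succ) h).const_mul (tang i j)))
  simp only [gMetric_apply]
  exact this.congr_grad (fun x _ => by ring) (fun x _ => by ring)

/-- The Christoffel symbols of `g` in closed form. -/
noncomputable def chris (η : ℝ → ℝ) (α₀ : Fin n) (k i j : Fin (n + 1)) (x : Coord n) : ℝ :=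
  -(kron i 0 * kron j 0 * kron k 0) * invRho x
    + tang i j * kron k 0 * (warp η α₀.succ x * (invRho x - slopeRho η α₀.succ x))
    + (kron i 0 * tang j k + kron j 0 * tang i k) * (slopeRho η α₀.succ x - invRho x)
    + (kron i α₀.succ * tang j k + kron j α₀.succ * tang i k - kron k α₀.succ * tang i j)
      * slopeY η α₀.succ x

lemma christoffel_gMetric (h : IsTailConst η) {x : Coord n} (hx : x ∈ openCollar n 1)
    (k i j : Fin (n + 1)) : christoffel (gMetric η α₀) k i j x = chris η α₀ k i j x := by
  simp only [christoffel, gMetric_inv_apply hx, (hasGrad_gMetric h _ _).pd_eq hx]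
  set r := invRho x with hr_def
  set E := warp η α₀.succ x
  set a := slopeRho η α₀.succ x with ha
  set b := slopeY η α₀.succ x with hb
  have hr : r * x 0 = 1 := inv_mul_cancel₀ hx.1.ne'
  have hE : E⁻¹ * E = 1 := inv_mul_cancel₀ (warp_pos x).ne'
  have key := sum_blocks α₀ i k k j (x 0 * x 0 * kron k 0) (x 0 * x 0 * E⁻¹) 0 0
    (2 * (r * r) * (-(r * (kron i 0 * kron j 0)) + tang i j * (E * (r - a))))
    (2 * (r * r) * (kron i 0 * (E * (a - r)) + kron i α₀.succ * (b * E)))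
    (2 * (r * r) * (kron j 0 * (E * (a - r)) + kron j α₀.succ * (b * E)))
    (-(2 * (r * r) * tang i j * (b * E)))
  -- Stated for an arbitrary summand F: the contraction is done once in block form, and matching the
  -- Christoffel formula to it is then a termwise ring identity.
  have hsum : ∀ F : Fin (n + 1) → ℝ, (∀ m, F m =
      (x 0 * x 0 * kron k 0 * kron m 0 + x 0 * x 0 * E⁻¹ * tang k m + 0 * tang k m
          + 0 * kron m α₀.succ) *
        (2 * (r * r) * (-(r * (kron i 0 * kron j 0)) + tang i j * (E * (r - a))) * kron m 0
          + 2 * (r * r) * (kron i 0 * (E * (a - r)) + kron i α₀.succ * (b * E)) * tang m j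
          + 2 * (r * r) * (kron j 0 * (E * (a - r)) + kron j α₀.succ * (b * E)) * tang i m
          + -(2 * (r * r) * tang i j * (b * E)) * kron m α₀.succ)) →
      (1 / 2) * ∑ m, F m = chris η α₀ k i j x := by
    intro F hF
    rw [Finset.sum_congr rfl fun m _ => hF m, key, chris, tang_comm k j, ← hr_def, ← ha, ← hb,
      show warp η α₀.succ x = E from rfl]
    have e1 : x 0 * x 0 * (r * r) = 1 := by linear_combination (r * x 0 + 1) * hr
    linear_combination (kron k 0 * (-(r * (kron i 0 * kron j 0)) + tang i j * (E * (r - a)))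
      + (E⁻¹ * E) * ((kron i 0 * (a - r) + kron i α₀.succ * b) * tang j k +
        (kron j 0 * (a - r) + kron j α₀.succ * b) * tang i k
        - tang i j * b * kron k α₀.succ)) * e1
      + ((kron i 0 * (a - r) + kron i α₀.succ * b) * tang j k +
        (kron j 0 * (a - r) + kron j α₀.succ * b) * tang i k
        - tang i j * b * kron k α₀.succ) * hE
  refine hsum _ fun m => ?_
  rw [tang_comm m j]
  ring

lemma hasGrad_chris (h : IsTailConst η) (k i j : Fin (n + 1)) :
    HasGrad α₀.succ (chris η α₀ k i j)
      (fun x => kron i 0 * kron j 0 * kron k 0 * (invRho x * invRho x)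
        + tang i j * kron k 0 * (warp η α₀.succ x *
          (2 * slopeRho η α₀.succ x * (invRho x - slopeRho η α₀.succ x)
            - invRho x * invRho x - hessRho η α₀.succ x))
        + (kron i 0 * tang j k + kron j 0 * tang i k) *
          (hessRho η α₀.succ x + invRho x * invRho x)
        + (kron i α₀.succ * tang j k + kron j α₀.succ * tang i k - kron k α₀.succ * tang i j)
          * hessMixed η α₀.succ x)
      (fun x => tang i j * kron k 0 * (warp η α₀.succ x *
          (2 * slopeY η α₀.succ x * (invRho x - slopeRho η α₀.succ x) - hessMixed η α₀.succ x))
        + (kron i 0 * tang j k + kron j 0 * tang i k) * hessMixed η α₀.succ x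
        + (kron i α₀.succ * tang j k + kron j α₀.succ * tang i k - kron k α₀.succ * tang i j)
          * hessY η α₀.succ x) := by
  have hr := hasGrad_invRho (n := n) α₀.succ
  have ha := hasGrad_slopeRho (p := α₀.succ) h
  have hb := hasGrad_slopeY (p := α₀.succ) h
  have hE := hasGrad_warp (p := α₀.succ) h
  exact ((((hr.const_mul (-(kron i 0 * kron j 0 * kron k 0))).add
    ((hE.mul (hr.sub ha)).const_mul (tang i j * kron k 0))).add
    ((ha.sub hr).const_mul (kron i 0 * tang j k + kron j 0 * tang i k))).add
    (hb.const_mul (kron i α₀.succ * tang j k + kron j α₀.succ * tang i k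
      - kron k α₀.succ * tang i j))).congr_grad
    (fun x _ => by ring) (fun x _ => by ring)

/-! ### The curvature -/

/-- The components `R_{ijk}^l + g_{jk} δ_i^l - g_{ik} δ_j^l` in closed form. -/
noncomputable def defectEndo (η : ℝ → ℝ) (α₀ : Fin n) (i j k l : Fin (n + 1)) (x : Coord n) : ℝ :=
  (hessRho η α₀.succ x + slopeRho η α₀.succ x * slopeRho η α₀.succ x
      - slopeRho η α₀.succ x * invRho x) *
    (warp η α₀.succ x * (kron j 0 * kron l 0 * tang i k - kron i 0 * kron l 0 * tang j k)
      + (kron i 0 * kron k 0 * tang j l - kron j 0 * kron k 0 * tang i l))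
  + hessMixed η α₀.succ x *
    ((kron k 0 * (kron i α₀.succ * tang j l - kron j α₀.succ * tang i l)
        + kron i 0 * (kron k α₀.succ * tang j l - kron l α₀.succ * tang j k)
        - kron j 0 * (kron k α₀.succ * tang i l - kron l α₀.succ * tang i k))
      - warp η α₀.succ x *
        (kron l 0 * (kron i α₀.succ * tang j k - kron j α₀.succ * tang i k)))
  + (slopeY η α₀.succ x * slopeY η α₀.succ x - hessY η α₀.succ x) *
    (kron j α₀.succ * kron k α₀.succ * tang i l - kron j α₀.succ * kron l α₀.succ * tang i k
      - kron i α₀.succ * kron k α₀.succ * tang j l + kron i α₀.succ * kron l α₀.succ * tang j k)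
  - (slopeY η α₀.succ x * slopeY η α₀.succ x + warp η α₀.succ x *
      (slopeRho η α₀.succ x * slopeRho η α₀.succ x
        - 2 * (slopeRho η α₀.succ x * invRho x))) *
    (tang j k * tang i l - tang i k * tang j l)

lemma sum_chris_mul_chris (i j k l : Fin (n + 1)) (x : Coord n) :
    ∑ m, chris η α₀ m j k x * chris η α₀ l i m x =
      (-(kron j 0 * kron k 0) * invRho x
          + tang j k * (warp η α₀.succ x * (invRho x - slopeRho η α₀.succ x))) *
        (-(kron i 0 * kron l 0) * invRho x + tang i l * (slopeRho η α₀.succ x - invRho x))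
      + (kron k 0 * (slopeRho η α₀.succ x - invRho x) + kron k α₀.succ * slopeY η α₀.succ x) *
        ((kron i 0 * (slopeRho η α₀.succ x - invRho x) + kron i α₀.succ * slopeY η α₀.succ x)
            * tang j l
          + (kron l 0 * (warp η α₀.succ x * (invRho x - slopeRho η α₀.succ x))
            - kron l α₀.succ * slopeY η α₀.succ x) * tang i j
          + tang i l * slopeY η α₀.succ x * kron j α₀.succ)
      + (kron j 0 * (slopeRho η α₀.succ x - invRho x) + kron j α₀.succ * slopeY η α₀.succ x) *
        ((kron i 0 * (slopeRho η α₀.succ x - invRho x) + kron i α₀.succ * slopeY η α₀.succ x)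
            * tang k l
          + (kron l 0 * (warp η α₀.succ x * (invRho x - slopeRho η α₀.succ x))
            - kron l α₀.succ * slopeY η α₀.succ x) * tang i k
          + tang i l * slopeY η α₀.succ x * kron k α₀.succ)
      + -(tang j k * slopeY η α₀.succ x) *
        ((kron i 0 * (slopeRho η α₀.succ x - invRho x) + kron i α₀.succ * slopeY η α₀.succ x)
            * kron l α₀.succ
          + (kron l 0 * (warp η α₀.succ x * (invRho x - slopeRho η α₀.succ x))
            - kron l α₀.succ * slopeY η α₀.succ x) * kron i α₀.succ
          + tang i l * slopeY η α₀.succ x) := by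
  rw [← sum_blocks]
  refine Finset.sum_congr rfl fun m _ => ?_
  simp only [chris]
  ring

lemma curvEndo_gMetric (h : IsTailConst η) {x : Coord n} (hx : x ∈ openCollar n 1)
    (i j k l : Fin (n + 1)) :
    curvEndo (gMetric η α₀) i j k l x = defectEndo η α₀ i j k l x
      - (gMetric η α₀ x j k * kron i l - gMetric η α₀ x i k * kron j l) := by
  have e : ∀ m k i j, pd m (christoffel (gMetric η α₀) k i j) x = _ := fun m k i j =>
    (pd_congr (fun z hz => christoffel_gMetric h hz k i j) hx m).trans
      ((hasGrad_chris h k i j).pd_eq hx m)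
  rw [curvEndo, e, e]
  simp only [christoffel_gMetric h hx, Finset.sum_sub_distrib, sum_chris_mul_chris]
  rw [gMetric_apply, gMetric_apply, kron_eq i l, kron_eq j l, defectEndo, tang_comm j i]
  -- Once each index is known to be normal or tangential, the deltas involving 0 are evaluated. The
  -- remaining ones act as free variables, which leaves sixteen polynomial identities independent of
  -- n.
  rcases Fin.eq_zero_or_eq_succ i with rfl | ⟨i, rfl⟩ <;>
  rcases Fin.eq_zero_or_eq_succ j with rfl | ⟨j, rfl⟩ <;>
  rcases Fin.eq_zero_or_eq_succ k with rfl | ⟨k, rfl⟩ <;>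
  rcases Fin.eq_zero_or_eq_succ l with rfl | ⟨l, rfl⟩ <;>
  simp only [kron_self, kron_succ_zero, kron_zero_succ, tang_zero_left, tang_zero_right] <;>
  ring

/-! ### The deviation from constant curvature `-1` -/

lemma IsSymbol.sum {ι : Type*} {q : ℝ} (hq : 0 ≤ q) (s : Finset ι) {F : ι → Coord n → ℝ}
    (h : ∀ i ∈ s, IsSymbol q (F i)) : IsSymbol q (fun x => ∑ i ∈ s, F i x) := by
  classical
  induction s using Finset.induction_on with
  | empty => simpa using (IsSymbol.const (n := n) 0).mono hq
  | insert i s hi ih =>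
    simp only [Finset.sum_insert hi]
    exact (h i (Finset.mem_insert_self i s)).add
      (ih fun j hj => h j (Finset.mem_insert_of_mem hj))

/-- The components `R_{ijkl} + g_{jk} g_{il} - g_{ik} g_{jl}`. -/
noncomputable def defect (η : ℝ → ℝ) (α₀ : Fin n) (i j k l : Fin (n + 1)) (x : Coord n) : ℝ :=
  ∑ m, defectEndo η α₀ i j k m x * gMetric η α₀ x m l

lemma Rm_gMetric (h : IsTailConst η) {x : Coord n} (hx : x ∈ openCollar n 1)
    (i j k l : Fin (n + 1)) :
    Rm (gMetric η α₀) i j k l x = defect η α₀ i j k l x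
      - (gMetric η α₀ x j k * gMetric η α₀ x i l - gMetric η α₀ x i k * gMetric η α₀ x j l) := by
  simp only [Rm, curvEndo_gMetric h hx, defect, sub_mul, Finset.sum_sub_distrib, mul_assoc,
    ← Finset.mul_sum]
  simp only [kron_comm i, kron_comm j, sum_kron_mul]

lemma isSymbol_gMetric (h : IsCutoff η) (i j : Fin (n + 1)) :
    IsSymbol 2 (fun x => gMetric η α₀ x i j) := by
  simp only [gMetric_apply]
  exact ((isSymbol_invRho.mul isSymbol_invRho).mul ((IsSymbol.const _).add
    ((isSymbol_warp h).const_mul _))).mono (by norm_num)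

/-- The ρ^{-2} terms are gone, and each coefficient in `defectEndo` is at worst of order 1: the
second derivatives of f/2, a/ρ, a² and b², with b of order 1/2. The factor e^f is of order 0. -/
lemma isSymbol_defectEndo (h : IsCutoff η) (i j k l : Fin (n + 1)) :
    IsSymbol 1 (defectEndo η α₀ i j k l) := by
  have ht := h.isTailConst
  have hE := isSymbol_warp (p := α₀.succ) h
  have ha := isSymbol_slopeRho (p := α₀.succ) ht
  have hb := isSymbol_slopeY (p := α₀.succ) ht
  have hr : IsSymbol 1 (invRho : Coord n → ℝ) := isSymbol_invRho
  have har : IsSymbol 1 (fun x => slopeRho η α₀.succ x * invRho x) := (ha.mul hr).mono (by norm_num)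
  have haa : IsSymbol 1 (fun x => slopeRho η α₀.succ x * slopeRho η α₀.succ x) :=
    (ha.mul ha).mono (by norm_num)
  have hbb : IsSymbol 1 (fun x => slopeY η α₀.succ x * slopeY η α₀.succ x) :=
    (hb.mul hb).mono (by norm_num)
  have mc : ∀ {F : Coord n → ℝ} (_ : IsSymbol 1 F) (c : ℝ), IsSymbol 1 (fun x => F x * c) :=
    fun hF c => (hF.mul (IsSymbol.const c)).mono (by norm_num)
  have aff : ∀ {F : Coord n → ℝ} (_ : IsSymbol 1 F) {G : Coord n → ℝ} (_ : IsSymbol 0 G),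
      IsSymbol 1 (fun x => F x * G x) := fun hF _ hG => (hF.mul hG).mono (by norm_num)
  have em : ∀ c : ℝ, IsSymbol 0 (fun x => warp η α₀.succ x * c) := fun c =>
    (hE.mul (IsSymbol.const c)).mono (by norm_num)
  have t1 := aff (((isSymbol_hessRho (p := α₀.succ) ht).add haa).sub har)
    ((em (kron j 0 * kron l 0 * tang i k - kron i 0 * kron l 0 * tang j k)).add
      (IsSymbol.const (kron i 0 * kron k 0 * tang j l - kron j 0 * kron k 0 * tang i l)))
  have t2 := aff (isSymbol_hessMixed (p := α₀.succ) ht)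
    ((IsSymbol.const (kron k 0 * (kron i α₀.succ * tang j l - kron j α₀.succ * tang i l)
        + kron i 0 * (kron k α₀.succ * tang j l - kron l α₀.succ * tang j k)
        - kron j 0 * (kron k α₀.succ * tang i l - kron l α₀.succ * tang i k))).sub
      (em (kron l 0 * (kron i α₀.succ * tang j k - kron j α₀.succ * tang i k))))
  have t3 := mc (hbb.sub (isSymbol_hessY (p := α₀.succ) ht))
    (kron j α₀.succ * kron k α₀.succ * tang i l - kron j α₀.succ * kron l α₀.succ * tang i k
      - kron i α₀.succ * kron k α₀.succ * tang j l + kron i α₀.succ * kron l α₀.succ * tang j k)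
  have t4 := mc (hbb.add ((hE.mul (haa.sub (har.const_mul 2))).mono (by norm_num)))
    (tang j k * tang i l - tang i k * tang j l)
  exact ((t1.add t2).add t3).sub t4

lemma isSymbol_defect (h : IsCutoff η) (i j k l : Fin (n + 1)) :
    IsSymbol 3 (defect η α₀ i j k l) :=
  .sum (by norm_num) _ fun m _ =>
    ((isSymbol_defectEndo h i j k m).mul (isSymbol_gMetric h m l)).mono (by norm_num)

lemma isOrder_chris (h : IsCutoff η) (k i j : Fin (n + 1)) : IsOrder 1 (chris η α₀ k i j) := by
  have ht := h.isTailConst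
  have hE := (isSymbol_warp (p := α₀.succ) h).order
  have ha := ((isSymbol_slopeRho (p := α₀.succ) ht).order).mono (q' := 1) (by norm_num)
  have hb := ((isSymbol_slopeY (p := α₀.succ) ht).order).mono (q' := 1) (by norm_num)
  have hr : IsOrder 1 (invRho : Coord n → ℝ) := isOrder_invRho
  exact (((hr.const_mul _).add (((hE.mul (hr.sub ha)).mono (by norm_num)).const_mul _)).add
    ((ha.sub hr).const_mul _)).add (hb.const_mul _)

/-! ### Covariant derivatives -/

lemma gMetric_symm (x : Coord n) (i j : Fin (n + 1)) :
    gMetric η α₀ x i j = gMetric η α₀ x j i := by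
  rw [gMetric_apply, gMetric_apply, tang_comm, mul_comm (kron i 0)]

/-- The Christoffel symbols with the upper index lowered. -/
noncomputable def chrisLow (η : ℝ → ℝ) (α₀ : Fin n) (m i j : Fin (n + 1)) (x : Coord n) : ℝ :=
  ∑ s, chris η α₀ s m i x * gMetric η α₀ x s j

lemma sum_chris_mul_gMetric (m i j : Fin (n + 1)) (x : Coord n) :
    ∑ s, chris η α₀ s m i x * gMetric η α₀ x s j = chrisLow η α₀ m i j x := rfl

/-- This is ∇g = 0, the input for cancelling the constant curvature part of ∇Rm. -/
lemma pd_gMetric (h : IsTailConst η) {x : Coord n} (hx : x ∈ openCollar n 1)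
    (m i j : Fin (n + 1)) :
    pd m (fun z => gMetric η α₀ z i j) x = chrisLow η α₀ m i j x + chrisLow η α₀ m j i x := by
  have key : ∀ i j, chrisLow η α₀ m i j x = _ := fun i j =>
    (Finset.sum_congr rfl fun s _ => by rw [chris, gMetric_apply]; ring).trans
      (sum_blocks α₀ i i m j
        (-(kron m 0 * kron i 0) * invRho x
          + tang m i * (warp η α₀.succ x * (invRho x - slopeRho η α₀.succ x)))
        (kron m 0 * (slopeRho η α₀.succ x - invRho x) + kron m α₀.succ * slopeY η α₀.succ x)
        (kron i 0 * (slopeRho η α₀.succ x - invRho x) + kron i α₀.succ * slopeY η α₀.succ x)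
        (-(tang m i * slopeY η α₀.succ x))
        (invRho x * invRho x * kron j 0) (invRho x * invRho x * warp η α₀.succ x) 0 0)
  rw [(hasGrad_gMetric h i j).pd_eq hx, key, key, tang_comm j i]
  ring

/-- The tensor g_{jk}g_{il} - g_{ik}g_{jl} is parallel, so Rm and the defect have the same covariant
derivative. After expansion, all terms quadratic in g are products of a metric component with a
lowered Christoffel symbol, and they cancel. -/
lemma covRm_gMetric (h : IsCutoff η) {x : Coord n} (hx : x ∈ openCollar n 1)
    (m i j k l : Fin (n + 1)) :
    covRm (gMetric η α₀) m i j k l x = pd m (defect η α₀ i j k l) x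
      - ∑ s, (chris η α₀ s m i x * defect η α₀ s j k l x
        + chris η α₀ s m j x * defect η α₀ i s k l x
        + chris η α₀ s m k x * defect η α₀ i j s l x
        + chris η α₀ s m l x * defect η α₀ i j k s x) := by
  have ht := h.isTailConst
  have hd : ∀ i j, DifferentiableAt ℝ (fun z => gMetric η α₀ z i j) x := fun i j =>
    (isSymbol_gMetric h i j).1 x hx
  have hpd : pd m (Rm (gMetric η α₀) i j k l) x = pd m (defect η α₀ i j k l) x
      - ((gMetric η α₀ x j k * (chrisLow η α₀ m i l x + chrisLow η α₀ m l i x)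
          + (chrisLow η α₀ m j k x + chrisLow η α₀ m k j x) * gMetric η α₀ x i l)
        - (gMetric η α₀ x i k * (chrisLow η α₀ m j l x + chrisLow η α₀ m l j x)
          + (chrisLow η α₀ m i k x + chrisLow η α₀ m k i x) * gMetric η α₀ x j l)) := by
    rw [pd_congr (fun z hz => Rm_gMetric ht hz i j k l) hx,
      pd_sub ((isSymbol_defect h i j k l).1 x hx)
        (((hd j k).fun_mul (hd i l)).fun_sub ((hd i k).fun_mul (hd j l))),
      pd_sub ((hd j k).fun_mul (hd i l)) ((hd i k).fun_mul (hd j l)),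
      pd_mul (hd j k) (hd i l), pd_mul (hd i k) (hd j l)]
    simp only [pd_gMetric ht hx]
  have hs : ∀ s, christoffel (gMetric η α₀) s m i x * Rm (gMetric η α₀) s j k l x
        + christoffel (gMetric η α₀) s m j x * Rm (gMetric η α₀) i s k l x
        + christoffel (gMetric η α₀) s m k x * Rm (gMetric η α₀) i j s l x
        + christoffel (gMetric η α₀) s m l x * Rm (gMetric η α₀) i j k s x
      = (chris η α₀ s m i x * defect η α₀ s j k l x + chris η α₀ s m j x * defect η α₀ i s k l x
        + chris η α₀ s m k x * defect η α₀ i j s l x + chris η α₀ s m l x * defect η α₀ i j k s x)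
        - (gMetric η α₀ x j k * (chris η α₀ s m i x * gMetric η α₀ x s l)
          - gMetric η α₀ x j l * (chris η α₀ s m i x * gMetric η α₀ x s k)
          + gMetric η α₀ x i l * (chris η α₀ s m j x * gMetric η α₀ x s k)
          - gMetric η α₀ x i k * (chris η α₀ s m j x * gMetric η α₀ x s l)
          + gMetric η α₀ x i l * (chris η α₀ s m k x * gMetric η α₀ x s j)
          - gMetric η α₀ x j l * (chris η α₀ s m k x * gMetric η α₀ x s i)
          + gMetric η α₀ x j k * (chris η α₀ s m l x * gMetric η α₀ x s i)
          - gMetric η α₀ x i k * (chris η α₀ s m l x * gMetric η α₀ x s j)) := fun s => by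
    simp only [christoffel_gMetric ht hx, Rm_gMetric ht hx]
    rw [gMetric_symm x j s, gMetric_symm x i s]
    ring
  rw [covRm, hpd, Finset.sum_congr rfl fun s _ => hs s, Finset.sum_sub_distrib]
  simp only [Finset.sum_add_distrib, Finset.sum_sub_distrib, ← Finset.mul_sum]
  simp only [sum_chris_mul_gMetric]
  ring

lemma isOrder_covRm (h : IsCutoff η) (m i j k l : Fin (n + 1)) :
    IsOrder 4 (covRm (gMetric η α₀) m i j k l) := by
  refine IsOrder.congr ?_ fun x hx => covRm_gMetric h hx m i j k l
  have hm : ∀ {s u v i j k l : Fin (n + 1)},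
      IsOrder 4 (fun x => chris η α₀ s u v x * defect η α₀ i j k l x) := fun {s u v i j k l} =>
    ((isOrder_chris h s u v).mul (isSymbol_defect h i j k l).order).mono (by norm_num)
  exact (((isSymbol_defect h i j k l).pd_order m).mono (by norm_num)).sub
    (.sum _ fun s _ => ((hm.add hm).add hm).add hm)

lemma isOrder_gMetric_inv (h : IsCutoff η) (i j : Fin (n + 1)) :
    IsOrder (-2) (fun x => (gMetric η α₀ x)⁻¹ i j) := by
  have h0 : IsOrder (-2) (fun x : Coord n => x 0 * x 0) := ⟨1, fun x hx => by
    rw [abs_of_pos (mul_pos hx.1 hx.1), neg_neg, one_mul, Real.rpow_two, sq]⟩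
  have hE : IsOrder 0 (fun x => (warp η α₀.succ x)⁻¹) := .of_bound (C := (Real.exp (-2))⁻¹)
    fun x hx => by
      rw [abs_of_pos (inv_pos.2 (warp_pos x))]
      exact inv_anti₀ (Real.exp_pos _) (le_warp h hx)
  exact ((h0.mul ((IsOrder.const _).add (hE.const_mul (tang i j)))).mono (by norm_num)).congr
    fun x hx => gMetric_inv_apply hx i j

theorem exists_normCovRm_le (h : IsCutoff η) :
    ∃ C : ℝ, ∀ x ∈ openCollar n 1, normCovRm (gMetric η α₀) x ≤ C * x 0 := by
  have key : IsOrder (-2) (fun x => ∑ I : Fin 5 → Fin (n + 1), ∑ J : Fin 5 → Fin (n + 1),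
      (∏ a, (gMetric η α₀ x)⁻¹ (I a) (J a))
        * covRm (gMetric η α₀) (I 0) (I 1) (I 2) (I 3) (I 4) x
        * covRm (gMetric η α₀) (J 0) (J 1) (J 2) (J 3) (J 4) x) := by
    refine .sum _ fun I _ => .sum _ fun J _ => ?_
    simp only [Fin.prod_univ_five]
    have hg := fun a => isOrder_gMetric_inv (α₀ := α₀) h (I a) (J a)
    exact (((((((hg 0).mul (hg 1)).mul (hg 2)).mul (hg 3)).mul (hg 4)).mul
      -- Orders add up to 5·(-2) + 4 + 4 = -2, so the squared norm is O(ρ²).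
      (isOrder_covRm h _ _ _ _ _)).mul (isOrder_covRm h _ _ _ _ _)).mono (by norm_num)
  obtain ⟨C, hC⟩ := key
  refine ⟨Real.sqrt C, fun x hx => ?_⟩
  have h1 := (le_abs_self _).trans (hC x hx)
  rw [neg_neg, Real.rpow_two] at h1
  refine (Real.sqrt_le_sqrt h1).trans_eq ?_
  rw [Real.sqrt_mul' _ (sq_nonneg _), Real.sqrt_sq hx.1.le]

/-! ### Sectional curvature -/

lemma metricVal_gMetric (x v w : Coord n) :
    metricVal (gMetric η α₀) x v w =
      ∑ i, (x 0 ^ 2)⁻¹ * (if i = 0 then 1 else warp η α₀.succ x) * v i * w i := by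
  simp [metricVal, gMetric, gBar, warp, Matrix.diagonal_apply, mul_ite, ite_mul]

lemma le_weight (h : IsCutoff η) {x : Coord n} (hx : x ∈ openCollar n 1) (i : Fin (n + 1)) :
    Real.exp (-2) ≤ if i = 0 then 1 else warp η α₀.succ x := by
  split_ifs
  · exact Real.exp_le_one_iff.2 (by norm_num)
  · exact le_warp h hx

lemma weight_le (h : IsCutoff η) {x : Coord n} (hx : x ∈ openCollar n 1) (i : Fin (n + 1)) :
    (if i = 0 then 1 else warp η α₀.succ x) ≤ Real.exp 2 := by
  split_ifs
  · exact Real.one_le_exp (by norm_num)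
  · exact warp_le h hx

lemma le_metricVal (h : IsCutoff η) {x : Coord n} (hx : x ∈ openCollar n 1) (v : Coord n)
    (i : Fin (n + 1)) :
    (x 0 ^ 2)⁻¹ * (if i = 0 then 1 else warp η α₀.succ x) * v i * v i
      ≤ metricVal (gMetric η α₀) x v v := by
  rw [metricVal_gMetric]
  refine Finset.single_le_sum (f := fun i =>
    (x 0 ^ 2)⁻¹ * (if i = 0 then 1 else warp η α₀.succ x) * v i * v i) (fun j _ => ?_)
    (Finset.mem_univ i)
  have := (Real.exp_pos (-2)).le.trans (le_weight (α₀ := α₀) h hx j)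
  rw [mul_assoc]
  exact mul_nonneg (mul_nonneg (inv_nonneg.2 (sq_nonneg _)) this) (mul_self_nonneg _)

/-- g is diagonal with entries at least e^{-2}ρ^{-2}, since |f| ≤ 2. This bounds the components of
unit vectors by eρ, and also the coordinate speeds of curves in the completeness proof. -/
lemma abs_coord_le (h : IsCutoff η) {x : Coord n} (hx : x ∈ openCollar n 1) (v : Coord n)
    (i : Fin (n + 1)) :
    |v i| ≤ Real.exp 1 * x 0 * Real.sqrt (metricVal (gMetric η α₀) x v v) := by
  have h1 := le_metricVal (α₀ := α₀) h hx v i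
  have h2 : Real.exp (-2) * (x 0 ^ 2)⁻¹ * (v i * v i) ≤ metricVal (gMetric η α₀) x v v := by
    refine le_trans ?_ h1
    rw [mul_assoc _ (v i), mul_comm (x 0 ^ 2)⁻¹]
    exact mul_le_mul_of_nonneg_right (mul_le_mul_of_nonneg_right (le_weight h hx i)
      (inv_nonneg.2 (sq_nonneg _))) (mul_self_nonneg _)
  have h3 : Real.exp 1 * Real.exp 1 * Real.exp (-2) = 1 := by
    rw [← Real.exp_add, ← Real.exp_add]; norm_num
  have h0 := hx.1
  have hpos : 0 ≤ Real.exp 1 * x 0 := by positivity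
  rw [← Real.sqrt_sq hpos, ← Real.sqrt_mul (sq_nonneg _)]
  refine Real.abs_le_sqrt ?_
  calc v i ^ 2 = (Real.exp 1 * x 0) ^ 2 * (Real.exp (-2) * (x 0 ^ 2)⁻¹ * (v i * v i)) := by
        have : x 0 ^ 2 * (x 0 ^ 2)⁻¹ = 1 := mul_inv_cancel₀ (by positivity)
        linear_combination (-(v i ^ 2)) * (x 0 ^ 2 * (x 0 ^ 2)⁻¹) * h3 - v i ^ 2 * this
    _ ≤ _ := mul_le_mul_of_nonneg_left h2 (sq_nonneg _)

lemma sec_gMetric (h : IsTailConst η) {x : Coord n} (hx : x ∈ openCollar n 1) {X Z : Coord n}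
    (hXZ : IsOrthonormalPair (gMetric η α₀) x X Z) :
    sec (gMetric η α₀) x X Z - (-1) =
      ∑ i, ∑ j, ∑ k, ∑ l, defect η α₀ i j k l x * X i * Z j * Z k * X l := by
  obtain ⟨h1, h2, h3⟩ := hXZ
  have e : ∀ i j k l, Rm (gMetric η α₀) i j k l x * X i * Z j * Z k * X l =
      defect η α₀ i j k l x * X i * Z j * Z k * X l
      - ((gMetric η α₀ x j k * Z j * Z k) * (gMetric η α₀ x i l * X i * X l)
        - (gMetric η α₀ x i k * X i * Z k) * (gMetric η α₀ x j l * Z j * X l)) := fun i j k l => by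
    rw [Rm_gMetric h hx]; ring
  simp only [sec, e, Finset.sum_sub_distrib]
  have e1 : ∑ i, ∑ j, ∑ k, ∑ l,
      (gMetric η α₀ x j k * Z j * Z k) * (gMetric η α₀ x i l * X i * X l) = 1 := by
    simp only [← Finset.mul_sum, ← Finset.sum_mul]
    change metricVal (gMetric η α₀) x Z Z * metricVal (gMetric η α₀) x X X = 1
    rw [h1, h2, mul_one]
  have e2 : ∑ i, ∑ j, ∑ k, ∑ l,
      (gMetric η α₀ x i k * X i * Z k) * (gMetric η α₀ x j l * Z j * X l) = 0 := by
    simp only [← Finset.mul_sum, ← Finset.sum_mul]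
    change metricVal (gMetric η α₀) x X Z * metricVal (gMetric η α₀) x Z X = 0
    rw [h3, zero_mul]
  rw [e1, e2]
  ring

theorem exists_abs_sec_le (h : IsCutoff η) :
    ∃ C : ℝ, ∀ x ∈ openCollar n 1, ∀ X Z : Coord n,
      IsOrthonormalPair (gMetric η α₀) x X Z →
        |sec (gMetric η α₀) x X Z - (-1)| ≤ C * x 0 := by
  choose C hC0 hC using fun i j k l => (isSymbol_defect (α₀ := α₀) h i j k l).order.exists_nonneg
  refine ⟨∑ i, ∑ j, ∑ k, ∑ l, C i j k l * Real.exp 1 ^ 4, fun x hx X Z hXZ => ?_⟩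
  rw [sec_gMetric h.isTailConst hx hXZ]
  have h0 := hx.1
  have hX : ∀ i, |X i| ≤ Real.exp 1 * x 0 := fun i => by
    have := abs_coord_le (α₀ := α₀) h hx X i
    rwa [hXZ.1, Real.sqrt_one, mul_one] at this
  have hZ : ∀ i, |Z i| ≤ Real.exp 1 * x 0 := fun i => by
    have := abs_coord_le (α₀ := α₀) h hx Z i
    rwa [hXZ.2.1, Real.sqrt_one, mul_one] at this
  have hterm : ∀ i j k l, |defect η α₀ i j k l x * X i * Z j * Z k * X l| ≤
      C i j k l * Real.exp 1 ^ 4 * x 0 := fun i j k l => by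
    simp only [abs_mul]
    have hpow : x 0 ^ (-(3 : ℝ)) = (x 0 ^ 3)⁻¹ := by
      rw [Real.rpow_neg h0.le]; norm_cast
    have hd := hC i j k l x hx
    rw [hpow] at hd
    calc _ ≤ C i j k l * (x 0 ^ 3)⁻¹ * (Real.exp 1 * x 0) * (Real.exp 1 * x 0)
          * (Real.exp 1 * x 0) * (Real.exp 1 * x 0) := by
          have := hC0 i j k l
          gcongr
          exacts [hX i, hZ j, hZ k, hX l]
      _ = _ := by field_simp
  simp only [Finset.sum_mul]
  refine (Finset.abs_sum_le_sum_abs _ _).trans (Finset.sum_le_sum fun i _ => ?_)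
  refine (Finset.abs_sum_le_sum_abs _ _).trans (Finset.sum_le_sum fun j _ => ?_)
  refine (Finset.abs_sum_le_sum_abs _ _).trans (Finset.sum_le_sum fun k _ => ?_)
  exact (Finset.abs_sum_le_sum_abs _ _).trans (Finset.sum_le_sum fun l _ => hterm i j k l)

/-! ### Completeness of the end -/

lemma exists_lift_abs_eq_norm (x : AddCircle (2 * Real.pi)) :
    ∃ d : ℝ, (d : AddCircle (2 * Real.pi)) = x ∧ |d| = ‖x‖ := by
  obtain ⟨y, rfl⟩ := QuotientAddGroup.mk_surjective x
  refine ⟨y - round ((2 * Real.pi)⁻¹ * y) * (2 * Real.pi), ?_, (AddCircle.norm_eq _).symm⟩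
  rw [AddCircle.coe_sub, sub_eq_iff_eq_add, left_eq_add, AddCircle.coe_eq_zero_iff]
  exact ⟨_, zsmul_eq_mul _ _⟩

/-- If the derivative of `u ∘ γ` is controlled by the speed of `γ`, then the variation of `u` is
controlled by the length. -/
lemma abs_sub_le_curveLength {g : MetricField n} {γ : ℝ → Coord n} {u : ℝ → ℝ} {K : ℝ}
    (hK : 0 ≤ K) (hu : ContDiffOn ℝ 1 u (Set.Icc 0 1))
    (hb : ∀ t ∈ Set.Icc (0 : ℝ) 1,
      |deriv u t| ≤ K * Real.sqrt (metricVal g (γ t) (deriv γ t) (deriv γ t))) :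
    ENNReal.ofReal |u 1 - u 0| ≤ ENNReal.ofReal K * curveLength g γ := by
  rw [← Real.enorm_eq_ofReal_abs]
  refine (enorm_sub_le_lintegral_deriv_of_contDiffOn_Icc hu zero_le_one).trans ?_
  rw [curveLength, ← MeasureTheory.lintegral_const_mul' _ _ ENNReal.ofReal_ne_top]
  refine MeasureTheory.setLIntegral_mono' measurableSet_Icc fun t ht => ?_
  rw [← ENNReal.ofReal_mul hK, Real.enorm_eq_ofReal_abs]
  exact ENNReal.ofReal_le_ofReal (hb t ht)

lemma deriv_coord {γ : ℝ → Coord n} (hγ : ContDiff ℝ 1 γ) (i : Fin (n + 1)) (t : ℝ) :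
    HasDerivAt (fun t => γ t i) (deriv γ t i) t :=
  hasDerivAt_pi.1 ((hγ.differentiable one_ne_zero) t).hasDerivAt i

/-- Along a curve, each coordinate speed is at most eρ times the g-speed. Dividing by ρ bounds the
variation of log ρ, and ρ < 1 bounds that of y; passing to the torus only decreases norms. -/
lemma coord_control_of_riemDist_lt (h : IsCutoff η) {p q : Torus n × ℝ} {ε : ℝ}
    (hd : riemDist (gMetric η α₀) p q < ENNReal.ofReal ε) :
    (∀ α, ‖p.1 α - q.1 α‖ ≤ Real.exp 1 * ε) ∧
      |Real.log p.2 - Real.log q.2| ≤ Real.exp 1 * ε := by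
  obtain ⟨⟨γ, hγ, hin, rfl, rfl⟩, hlen⟩ := iInf_lt_iff.1 hd
  have hε : 0 < ε := ENNReal.ofReal_pos.1 (lt_of_le_of_lt bot_le hlen)
  have he := (Real.exp_pos 1).le
  have bound : ∀ u : ℝ → ℝ, ENNReal.ofReal |u 1 - u 0| ≤
      ENNReal.ofReal (Real.exp 1) * curveLength (gMetric η α₀) γ →
      |u 0 - u 1| ≤ Real.exp 1 * ε := fun u hu => by
    rw [abs_sub_comm]
    have := hu.trans (mul_le_mul_right hlen.le _)
    rwa [← ENNReal.ofReal_mul he, ENNReal.ofReal_le_ofReal_iff (by positivity)] at this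
  have hcoord : ∀ t ∈ Set.Icc (0 : ℝ) 1, ∀ i, |deriv γ t i| ≤ Real.exp 1 * γ t 0 *
      Real.sqrt (metricVal (gMetric η α₀) (γ t) (deriv γ t) (deriv γ t)) := fun t ht i =>
    abs_coord_le h (hin t ht) _ i
  refine ⟨fun α => ?_, ?_⟩
  · have := bound (fun t => γ t α.succ) (abs_sub_le_curveLength he
      (contDiff_pi.1 hγ α.succ).contDiffOn fun t ht => ?_)
    · refine le_trans ?_ this
      rw [proj, proj, ← AddCircle.coe_sub]
      exact QuotientAddGroup.norm_mk_le_norm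
    · rw [(deriv_coord hγ α.succ t).deriv]
      refine (hcoord t ht α.succ).trans (mul_le_mul_of_nonneg_right ?_ (Real.sqrt_nonneg _))
      exact mul_le_of_le_one_right he (hin t ht).2.le
  · refine bound (fun t => Real.log (γ t 0)) (abs_sub_le_curveLength he
      ((contDiff_pi.1 hγ 0).contDiffOn.log fun t ht => (hin t ht).1.ne') fun t ht => ?_)
    have hpos := (hin t ht).1
    rw [((deriv_coord hγ 0 t).log hpos.ne').deriv, abs_div, abs_of_pos hpos, div_le_iff₀ hpos]
    refine (hcoord t ht 0).trans_eq (by ring)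

/-- The straight segment in the cover stays in c ≤ ρ < 1, where each of the n + 1 diagonal entries
of g is at most c^{-2}e². -/
lemma riemDist_proj_le (h : IsCutoff η) {x x' : Coord n} {c δ : ℝ} (hc : 0 < c)
    (hx : c ≤ x 0) (hx1 : x 0 < 1) (hx' : c ≤ x' 0) (hx1' : x' 0 < 1) (hδ : 0 ≤ δ)
    (hd : ∀ i, |x' i - x i| ≤ δ) :
    riemDist (gMetric η α₀) (proj x) (proj x') ≤
      ENNReal.ofReal (Real.sqrt ((n + 1) * ((c ^ 2)⁻¹ * Real.exp 2)) * δ) := by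
  set γ : ℝ → Coord n := fun t => x + t • (x' - x) with hγdef
  have hγ : ContDiff ℝ 1 γ := by fun_prop
  have hderiv : ∀ t, deriv γ t = x' - x := fun t => by
    have : HasDerivAt γ ((1 : ℝ) • (x' - x)) t := ((hasDerivAt_id t).smul_const _).const_add x
    rw [this.deriv, one_smul]
  have h0 : ∀ t ∈ Set.Icc (0 : ℝ) 1, c ≤ γ t 0 ∧ γ t 0 < 1 := fun t ht => by
    have : γ t 0 = (1 - t) * x 0 + t * x' 0 := by simp [hγdef]; ring
    rw [this]
    constructor
    · nlinarith [ht.1, ht.2, mul_nonneg ht.1 (sub_nonneg.2 hx'),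
        mul_nonneg (sub_nonneg.2 ht.2) (sub_nonneg.2 hx)]
    · rcases ht.1.eq_or_lt with rfl | ht0
      · simpa using hx1
      · nlinarith [mul_pos ht0 (sub_pos.2 hx1'),
          mul_nonneg (sub_nonneg.2 ht.2) (sub_pos.2 hx1).le]
  have hin : ∀ t ∈ Set.Icc (0 : ℝ) 1, γ t ∈ openCollar n 1 := fun t ht =>
    ⟨hc.trans_le (h0 t ht).1, (h0 t ht).2⟩
  refine (iInf_le _ ⟨γ, hγ, hin, by simp [hγdef], by simp [hγdef]⟩).trans ?_
  have hspeed : ∀ t ∈ Set.Icc (0 : ℝ) 1,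
      ENNReal.ofReal (Real.sqrt (metricVal (gMetric η α₀) (γ t) (deriv γ t) (deriv γ t))) ≤
        ENNReal.ofReal (Real.sqrt ((n + 1) * ((c ^ 2)⁻¹ * Real.exp 2)) * δ) := fun t ht => by
    refine ENNReal.ofReal_le_ofReal ?_
    rw [← Real.sqrt_sq hδ, ← Real.sqrt_mul (by positivity), hderiv, metricVal_gMetric]
    refine Real.sqrt_le_sqrt ((Finset.sum_le_card_nsmul _ _
      ((c ^ 2)⁻¹ * Real.exp 2 * δ ^ 2) fun i _ => ?_).trans_eq ?_)
    · rw [mul_assoc, Pi.sub_apply]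
      have h1 : (γ t 0 ^ 2)⁻¹ ≤ (c ^ 2)⁻¹ :=
        inv_anti₀ (by positivity) (pow_le_pow_left₀ hc.le (h0 t ht).1 2)
      have h2 : (x' i - x i) * (x' i - x i) ≤ δ ^ 2 := by
        rw [← sq, ← sq_abs]; exact pow_le_pow_left₀ (abs_nonneg _) (hd i) 2
      have h3 := (Real.exp_pos (-2)).le.trans (le_weight (α₀ := α₀) h (hin t ht) i)
      exact mul_le_mul (mul_le_mul h1 (weight_le h (hin t ht) i) h3 (by positivity)) h2
        (mul_self_nonneg _) (by positivity)
    · simp; ring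
  refine (MeasureTheory.setLIntegral_mono' measurableSet_Icc hspeed).trans ?_
  simp

/-- Cauchy sequences are Cauchy in log ρ and on the torus. The limit of ρ is an exponential, hence
positive, and near it the Riemannian distance is controlled by the coordinates. -/
theorem isCompleteEnd_gMetric (h : IsCutoff η) : IsCompleteEnd (gMetric η α₀) := by
  intro a ha0 ha1 u hu hcauchy
  have hcontrol : ∀ ε > 0, ∃ N, ∀ k ≥ N, ∀ m ≥ N, (∀ α, ‖(u k).1 α - (u m).1 α‖ < ε) ∧
      |Real.log (u k).2 - Real.log (u m).2| < ε := fun ε hε => by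
    have he := Real.exp_pos 1
    obtain ⟨N, hN⟩ := hcauchy (ENNReal.ofReal (ε / (2 * Real.exp 1)))
      (ENNReal.ofReal_pos.2 (by positivity))
    refine ⟨N, fun k hk m hm => ?_⟩
    obtain ⟨h1, h2⟩ := coord_control_of_riemDist_lt h (hN k hk m hm)
    have : Real.exp 1 * (ε / (2 * Real.exp 1)) < ε := by
      have : Real.exp 1 * (ε / (2 * Real.exp 1)) = ε / 2 := by field_simp
      linarith
    exact ⟨fun α => (h1 α).trans_lt this, h2.trans_lt this⟩
  have hlog : CauchySeq fun k => Real.log (u k).2 := Metric.cauchySeq_iff.2 fun ε hε => by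
    obtain ⟨N, hN⟩ := hcontrol ε hε
    exact ⟨N, fun k hk m hm => (hN k hk m hm).2⟩
  have htor : CauchySeq fun k => (u k).1 := Metric.cauchySeq_iff.2 fun ε hε => by
    obtain ⟨N, hN⟩ := hcontrol ε hε
    refine ⟨N, fun k hk m hm => (dist_pi_lt_iff hε).2 fun α => ?_⟩
    rw [dist_eq_norm]
    exact (hN k hk m hm).1 α
  obtain ⟨ℓ, hℓ⟩ := cauchySeq_tendsto_of_complete hlog
  obtain ⟨T, hT⟩ := cauchySeq_tendsto_of_complete htor
  have hrho : Tendsto (fun k => (u k).2) atTop (𝓝 (Real.exp ℓ)) := by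
    refine ((Real.continuous_exp.tendsto ℓ).comp hℓ).congr fun k => ?_
    exact Real.exp_log (hu k).1
  have hle : Real.exp ℓ ≤ a := le_of_tendsto' hrho fun k => (hu k).2
  refine ⟨(T, Real.exp ℓ), ⟨Real.exp_pos ℓ, hle⟩, ?_⟩
  choose y hy _ using fun α => exists_lift_abs_eq_norm (T α)
  -- Lifting the difference by its shortest representative makes y + d_k a lift of the k-th point as
  -- close to y as that point is to T on the torus.
  choose d hd hdn using fun k α => exists_lift_abs_eq_norm ((u k).1 α - T α)
  set c := Real.exp ℓ / 2 with hc
  have hc0 : 0 < c := by positivity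
  set K := Real.sqrt ((n + 1) * ((c ^ 2)⁻¹ * Real.exp 2)) with hK
  rw [ENNReal.tendsto_nhds_zero]
  intro ε hε
  have hK0 : 0 ≤ K := Real.sqrt_nonneg _
  obtain ⟨δ, hδ, hδε⟩ : ∃ δ : ℝ, 0 < δ ∧ ENNReal.ofReal (K * δ) ≤ ε := by
    rcases eq_or_ne ε ⊤ with rfl | hε'
    · exact ⟨1, one_pos, le_top⟩
    · refine ⟨ε.toReal / (K + 1), div_pos (ENNReal.toReal_pos hε.ne' hε') (by linarith), ?_⟩
      refine ENNReal.ofReal_le_of_le_toReal ?_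
      rw [mul_div_assoc', div_le_iff₀ (by linarith)]
      nlinarith [ENNReal.toReal_nonneg (a := ε)]
  have e1 : ∀ᶠ k in atTop, dist (u k).2 (Real.exp ℓ) < δ := (Metric.tendsto_nhds.1 hrho) δ hδ
  have e2 : ∀ᶠ k in atTop, dist (u k).1 T < δ := (Metric.tendsto_nhds.1 hT) δ hδ
  have e3 : ∀ᶠ k in atTop, c < (u k).2 :=
    hrho.eventually (lt_mem_nhds (half_lt_self (Real.exp_pos ℓ)))
  filter_upwards [e1, e2, e3] with k h1 h2 h3
  refine le_trans ?_ hδε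
  have p1 : proj (Fin.cons (u k).2 (fun α => y α + d k α) : Coord n) = u k := by
    refine Prod.ext (funext fun α => ?_) rfl
    simp only [proj, Fin.cons_succ, AddCircle.coe_add, hy, hd]
    abel
  have p2 : proj (Fin.cons (Real.exp ℓ) y : Coord n) = (T, Real.exp ℓ) :=
    Prod.ext (funext fun α => by simp [proj, hy]) rfl
  have := riemDist_proj_le (α₀ := α₀) h (x := Fin.cons (u k).2 (fun α => y α + d k α))
    (x' := Fin.cons (Real.exp ℓ) y) hc0 h3.le ((hu k).2.trans_lt ha1)
    (half_le_self (Real.exp_pos ℓ).le) (hle.trans_lt ha1) hδ.le (fun i => ?_)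
  · rwa [p1, p2] at this
  · refine Fin.cases ?_ (fun α => ?_) i
    · rw [Fin.cons_zero, Fin.cons_zero, abs_sub_comm]
      exact h1.le
    · rw [Fin.cons_succ, Fin.cons_succ, sub_add_cancel_left, abs_neg, hdn, ← dist_eq_norm]
      exact (dist_le_pi_dist _ _ α).trans h2.le

/-! ### The metrics `g` and `ḡ` -/

lemma gBar_apply (x : Coord n) (i j : Fin (n + 1)) :
    gBar η α₀ x i j = kron i 0 * kron j 0 + tang i j * warp η α₀.succ x := by
  rcases Fin.eq_zero_or_eq_succ i with rfl | ⟨α, rfl⟩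
  · rw [kron_self, tang_zero_left, kron]
    simp [gBar, Matrix.diagonal_apply, eq_comm]
  · rw [kron_succ_zero, tang_comm, tang_succ_right, kron_comm j α.succ]
    simp [gBar, Matrix.diagonal_apply, warp, kron, Fin.succ_ne_zero]

lemma posDef_gBar (x : Coord n) : (gBar η α₀ x).PosDef := by
  refine Matrix.PosDef.diagonal fun i => ?_
  split_ifs
  · exact one_pos
  · exact Real.exp_pos _

lemma gBar_periodic (x : Coord n) (α : Fin n) :
    gBar η α₀ (x + Pi.single α.succ (2 * Real.pi)) = gBar η α₀ x := by
  have h0 : (x + Pi.single α.succ (2 * Real.pi) : Coord n) 0 = x 0 := by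
    simp [(Fin.succ_ne_zero α).symm]
  have h1 : Real.sin ((x + Pi.single α.succ (2 * Real.pi) : Coord n) α₀.succ) = Real.sin (x α₀.succ) := by
    rw [Pi.add_apply, Pi.single_apply]
    split_ifs
    · exact Real.sin_add_two_pi _
    · rw [add_zero]
  unfold gBar potential
  rw [h0, h1]

lemma contDiffOn_warp (h : IsTailConst η) (p : Fin (n + 1)) :
    ContDiffOn ℝ ∞ (warp η p) (openCollar n 1) := by
  have h1 : ContDiff ℝ ∞ fun x : Coord n => (Real.sin (x p), x 0) := by fun_prop
  have h2 := (contDiffOn_scaleIntegral (k := 0) h).comp h1.contDiffOn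
    (s := openCollar n 1) fun x hx => hx.1
  have h3 := Real.contDiff_exp.comp_contDiffOn (contDiffOn_const (c := (2 : ℝ)).mul h2)
  refine h3.congr fun x _ => ?_
  simp only [warp, potential_eq]
  rfl

theorem isSmoothMetric_gMetric (h : IsCutoff η) : IsSmoothMetric (gMetric η α₀) where
  smooth i j := by
    have hr : ContDiffOn ℝ ∞ (invRho : Coord n → ℝ) (openCollar n 1) :=
      (contDiff_apply ℝ ℝ 0).contDiffOn.inv fun x hx => hx.1.ne'
    simp only [gMetric_apply]
    exact (hr.mul hr).mul (contDiffOn_const.add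
      (contDiffOn_const.mul (contDiffOn_warp h.isTailConst _)))
  posDef x hx := (posDef_gBar x).smul (inv_pos.2 (pow_pos hx.1 2))
  periodic x _ α := by
    simp only [gMetric, gBar_periodic]
    simp [(Fin.succ_ne_zero α).symm]

lemma rescale_gMetric (σ : Coord n → ℝ) (x : Coord n) :
    rescale σ (gMetric η α₀) x = (σ x ^ 2 * (x 0 ^ 2)⁻¹) • gBar η α₀ x :=
  smul_smul _ _ _

lemma rescale_rho_gMetric {x : Coord n} (hx : 0 < x 0) :
    rescale (fun z => z 0) (gMetric η α₀) x = gBar η α₀ x := by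
  rw [rescale_gMetric, mul_inv_cancel₀ (by positivity), one_smul]

theorem isGeodesicDefiningFunction_rho :
    IsGeodesicDefiningFunction ∞ 1 (gMetric η α₀) (fun x => x 0) where
  contDiffOn := (contDiff_apply ℝ ℝ 0).contDiffOn
  periodic x _ α := by simp [(Fin.succ_ne_zero α).symm]
  pos x hx := hx.1
  eq_zero x _ h := h
  diff_ne_zero x hx _ := by
    have hconv : Convex ℝ (closedCollar n 1) :=
      (convex_Ico (0 : ℝ) 1).linear_preimage
        (LinearMap.proj (R := ℝ) (φ := fun _ : Fin (n + 1) => ℝ) 0)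
    have hint : (interior (closedCollar n 1)).Nonempty := by
      have hsub : openCollar n 1 ⊆ closedCollar n 1 := fun x hx => ⟨hx.1.le, hx.2⟩
      refine ⟨fun _ => 1 / 2, interior_maximal hsub (isOpen_openCollar n 1) ?_⟩
      constructor <;> norm_num
    rw [((hasFDerivAt_apply (𝕜 := ℝ) 0 x).hasFDerivWithinAt).fderivWithin
      (uniqueDiffOn_convex hconv hint x hx)]
    intro hzero
    have := congrArg (fun L : Coord n →L[ℝ] ℝ => L (Pi.single 0 1)) hzero
    simp at this
  geodesic x hx := by
    have hpd : ∀ i, pd i (fun z : Coord n => z 0) x = kron i 0 := fun i => by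
      simpa using (hasGrad_rho α₀.succ).pd_eq hx i
    have hinv : ∀ i, (gBar η α₀ x)⁻¹ 0 i = kron i 0 := fun i => by
      have : (gBar η α₀ x)⁻¹ = Matrix.diagonal fun i : Fin (n + 1) =>
          if i = 0 then 1 else (Real.exp (potential η (x α₀.succ) (x 0)))⁻¹ := by
        refine Matrix.inv_eq_right_inv ?_
        rw [gBar, Matrix.diagonal_mul_diagonal, ← Matrix.diagonal_one]
        congr 1
        funext i
        split_ifs
        · norm_num
        · exact mul_inv_cancel₀ (Real.exp_pos _).ne'
      rw [this, Matrix.diagonal_apply, kron]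
      simp [eq_comm]
    have hsum : ∀ f : (Fin 1 → Fin (n + 1)) → ℝ, ∑ I, f I = ∑ i, f (fun _ => i) := fun f =>
      (Equiv.sum_comp (Equiv.funUnique (Fin 1) (Fin (n + 1))).symm f).symm
    rw [normDiff, tensorNorm, rescale_rho_gMetric hx.1, Real.sqrt_eq_one, hsum]
    simp only [hsum, Fin.prod_univ_one, hpd]
    have e : ∀ i j, (gBar η α₀ x)⁻¹ i j * kron i 0 * kron j 0 =
        kron i 0 * (kron j 0 * (gBar η α₀ x)⁻¹ i j) := fun i j => by ring
    simp only [e, ← Finset.mul_sum, sum_kron_mul, hinv, kron_self]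

/-! ### Continuity of `ḡ` up to the boundary -/

/-- Dominated convergence with bound |η| ≤ 1 works across s = 0 too: there `Real.sin y / 0 = 0` is
constant in y. Hence the formula for ḡ is itself the continuous extension to ρ = 0. -/
lemma continuousAt_potential (h : IsCutoff η) (y₀ ρ₀ : ℝ) :
    ContinuousAt (fun q : ℝ × ℝ => potential η q.1 q.2) (y₀, ρ₀) := by
  have hcont : ∀ s y : ℝ, ContinuousAt (fun y => η (Real.sin y / s)) y := fun s y =>
    (h.smooth.continuous.comp (Real.continuous_sin.div_const s)).continuousAt
  have hmeas : ∀ y : ℝ, Measurable fun s : ℝ => η (Real.sin y / s) := fun y =>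
    h.smooth.continuous.measurable.comp (measurable_const.div measurable_id)
  have key := intervalIntegral.continuousAt_parametric_primitive_of_dominated
    (μ := MeasureTheory.volume) (F := fun y s : ℝ => η (Real.sin y / s)) (fun _ => 1)
    (min 1 ρ₀ - 1) (max 1 ρ₀ + 1) (a₀ := 1) (b₀ := ρ₀) (x₀ := y₀)
    (fun y => (hmeas y).aestronglyMeasurable)
    (Eventually.of_forall fun y => Eventually.of_forall fun s => h.abs_le_one _)
    intervalIntegrable_const (Eventually.of_forall fun s => hcont s y₀)
    ⟨by linarith [min_le_left 1 ρ₀], by linarith [le_max_left 1 ρ₀]⟩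
    ⟨by linarith [min_le_right 1 ρ₀], by linarith [le_max_right 1 ρ₀]⟩ (by simp)
  refine (key.const_mul (-2)).congr (Eventually.of_forall fun q => ?_)
  simp only [potential]
  rw [intervalIntegral.integral_symm]
  ring

lemma continuous_warp (h : IsCutoff η) (p : Fin (n + 1)) : Continuous (warp η p) := by
  refine Real.continuous_exp.comp (continuous_iff_continuousAt.2 fun x => ?_)
  exact (continuousAt_potential h (x p) (x 0)).comp (f := fun x : Coord n => (x p, x 0))
    (by fun_prop)

theorem extendsContinuously_gBar (h : IsCutoff η) : ExtendsContinuously 1 (gBar η α₀) := by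
  refine ⟨gBar η α₀, ⟨fun _ _ => rfl, fun x _ => posDef_gBar x, fun x _ α => gBar_periodic x α⟩,
    fun i j => ?_⟩
  simp only [gBar_apply]
  exact (continuous_const.add (continuous_const.mul (continuous_warp h _))).continuousOn

/-! ### The tangential derivative of `ḡ` -/

lemma pd_gBar (h : IsTailConst η) {x : Coord n} (hx : x ∈ openCollar n 1) (i j : Fin (n + 1)) :
    pd α₀.succ (fun z => gBar η α₀ z i j) x =
      tang i j * (2 * slopeY η α₀.succ x * warp η α₀.succ x) := by
  simp only [gBar_apply]
  rw [((HasGrad.const (kron i 0 * kron j 0)).add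
    ((hasGrad_warp (p := α₀.succ) h).const_mul (tang i j))).pd_eq hx, kron_succ_zero, kron_self]
  ring

theorem exists_abs_pd_gBar_le (h : IsCutoff η) :
    ∃ C : ℝ, ∀ x ∈ openCollar n 1, ∀ i j : Fin (n + 1),
      |pd α₀.succ (fun z => gBar η α₀ z i j) x| ≤ C * |Real.log (x 0)| := by
  have ht := h.isTailConst
  obtain ⟨C, hC0, hC⟩ := ht.deriv.exists_bound
  refine ⟨2 * C * Real.exp 2, fun x hx i j => ?_⟩
  have h1 : |scaleFn (deriv η) 1 α₀.succ x| ≤ C * |Real.log (x 0)| := by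
    refine (abs_scaleIntegral_le hC _ hx.1 hx.2.le).trans ?_
    rw [integral_inv_pow_one hx.1]
    exact mul_le_mul_of_nonneg_left (neg_le_abs _) hC0
  have h2 : |tang i j| ≤ 1 := by unfold tang; split_ifs <;> simp
  rw [pd_gBar ht hx, slopeY]
  simp only [abs_mul, abs_two, abs_of_pos (warp_pos x)]
  calc |tang i j| * (2 * (|scaleFn (deriv η) 1 α₀.succ x| * |Real.cos (x α₀.succ)|)
        * warp η α₀.succ x)
      ≤ 1 * (2 * (C * |Real.log (x 0)| * 1) * Real.exp 2) := by
        have := (warp_pos (η := η) (p := α₀.succ) x).le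
        gcongr
        exacts [Real.abs_cos_le_one _, warp_le h hx]
    _ = _ := by ring

/-- The point `(ρ, 0, …, 0)`. -/
def axisPoint (n : ℕ) (ρ : ℝ) : Coord n := Fin.cons ρ 0

lemma axisPoint_mem {ρ a : ℝ} (h0 : 0 < ρ) (h1 : ρ < a) : axisPoint n ρ ∈ openCollar n a := ⟨h0, h1⟩

lemma IsCutoff.deriv_zero (h : IsCutoff η) : deriv η 0 = 1 := by
  have : η =ᶠ[𝓝 0] fun x => x := by
    filter_upwards [Icc_mem_nhds (by norm_num : -(1 / 2 : ℝ) < 0) (by norm_num : (0 : ℝ) < 1 / 2)]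
      with x hx using h.eq_self x hx
  rw [this.deriv_eq, deriv_id'']

lemma warp_axisPoint (h : IsCutoff η) (ρ : ℝ) : warp η α₀.succ (axisPoint n ρ) = 1 := by
  have : η 0 = 0 := h.eq_self 0 ⟨by norm_num, by norm_num⟩
  simp [warp, axisPoint, potential, this]

/-- At y = 0 the argument of η' is 0 for every s, and η'(0) = 1, so the integral is exactly ∫_ρ^1
ds/s. -/
lemma slopeY_axisPoint (h : IsCutoff η) {ρ : ℝ} (hρ : 0 < ρ) :
    slopeY η α₀.succ (axisPoint n ρ) = -Real.log ρ := by
  rw [← integral_inv_pow_one hρ]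
  simp [slopeY, scaleFn, scaleIntegral, axisPoint, h.deriv_zero]

lemma pd_warp_axisPoint (h : IsCutoff η) {ρ : ℝ} (h0 : 0 < ρ) (h1 : ρ < 1) :
    pd α₀.succ (warp η α₀.succ) (axisPoint n ρ) = -(2 * Real.log ρ) := by
  rw [(hasGrad_warp h.isTailConst).pd_eq (axisPoint_mem h0 h1), warp_axisPoint h,
    slopeY_axisPoint h h0, kron_succ_zero, kron_self]
  ring

lemma exists_lt_neg_log {a : ℝ} (ha : 0 < a) (B : ℝ) :
    ∃ ρ, 0 < ρ ∧ ρ < a ∧ B < -(2 * Real.log ρ) := by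
  -- With log ρ ≤ -(|B| + 1), the quantity -2 log ρ is at least 2|B| + 2.
  refine ⟨min (a / 2) (Real.exp (-(|B| + 1))), lt_min (by linarith) (Real.exp_pos _),
    (min_le_left _ _).trans_lt (by linarith), ?_⟩
  have h := Real.log_le_log (lt_min (by linarith : 0 < a / 2) (Real.exp_pos (-(|B| + 1))))
    (min_le_right (a / 2) (Real.exp (-(|B| + 1))))
  rw [Real.log_exp] at h
  linarith [le_abs_self B, abs_nonneg B]

theorem pd_gBar_unbounded (h : IsCutoff η) (α : Fin n) {a : ℝ} (ha : 0 < a) (ha1 : a ≤ 1) (B : ℝ) :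
    ∃ x ∈ openCollar n a, B < |pd α₀.succ (fun z => gBar η α₀ z α.succ α.succ) x| := by
  obtain ⟨ρ, h0, hρ, hB⟩ := exists_lt_neg_log ha B
  refine ⟨axisPoint n ρ, axisPoint_mem h0 hρ, hB.trans_le ?_⟩
  rw [pd_gBar h.isTailConst (axisPoint_mem h0 (hρ.trans_le ha1)), tang_succ_right, kron_self,
    warp_axisPoint h, slopeY_axisPoint h h0]
  exact (le_of_eq (by ring)).trans (le_abs_self _)

/-! ### Failure of the Lipschitz property -/

lemma warp_not_lipschitz_near_zero (h : IsCutoff η) {a r : ℝ} (ha : 0 < a) (ha1 : a ≤ 1)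
    (hr : 0 < r) (K : NNReal) :
    ¬ LipschitzOnWith K (warp η α₀.succ) (openCollar n a ∩ Metric.ball 0 r) := by
  intro hK
  obtain ⟨ρ, h0, hρ, hB⟩ := exists_lt_neg_log (lt_min ha hr) K
  have hmem : axisPoint n ρ ∈ openCollar n a ∩ Metric.ball 0 r := by
    refine ⟨axisPoint_mem h0 (hρ.trans_le (min_le_left _ _)), ?_⟩
    rw [mem_ball_zero_iff, pi_norm_lt_iff hr]
    refine fun i => Fin.cases ?_ (fun α => ?_) i
    · simpa [axisPoint, abs_of_pos h0] using hρ.trans_le (min_le_right _ _)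
    · simpa [axisPoint] using hr
  have hnhds := ((isOpen_openCollar n a).inter Metric.isOpen_ball).mem_nhds hmem
  have h1 := norm_fderiv_le_of_lipschitzOn ℝ hnhds hK
  have h2 : pd α₀.succ (warp η α₀.succ) (axisPoint n ρ) ≤ K := by
    have h3 := (fderiv ℝ (warp η α₀.succ) (axisPoint n ρ)).le_opNorm (Pi.single α₀.succ 1)
    rw [Pi.norm_single, norm_one, mul_one] at h3
    exact (le_abs_self _).trans (h3.trans h1)
  rw [pd_warp_axisPoint h h0 (hρ.trans_le ((min_le_left _ _).trans ha1))] at h2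
  linarith

/-- No metric in the conformal class of `ḡ` extends to a Lipschitz metric on a collar of the
boundary. -/
theorem not_extendsLipschitz_of_conformal (h : IsCutoff η) {a : ℝ} (ha : 0 < a) (ha1 : a ≤ 1)
    {k : MetricField n} (w : Coord n → ℝ) (hk : ∀ x ∈ openCollar n a, k x = w x • gBar η α₀ x) :
    ¬ ExtendsLipschitz a k := by
  rintro ⟨k', ⟨hext, hpos, -⟩, hlip⟩
  have hmem0 : (0 : Coord n) ∈ closedCollar n a := ⟨le_rfl, ha⟩
  have hsub : openCollar n a ⊆ closedCollar n a := fun x hx => ⟨hx.1.le, hx.2⟩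
  -- The (0, 0) entry of ḡ is 1, so this component of the extension recovers the conformal factor w;
  -- the next one recovers w e^f.
  have h00 : ∀ x ∈ openCollar n a, k' x 0 0 = w x := fun x hx => by
    rw [hext x hx, hk x hx, Matrix.smul_apply, gBar_apply, kron_self, tang_zero_left]; simp
  have hpp : ∀ x ∈ openCollar n a, k' x α₀.succ α₀.succ = w x * warp η α₀.succ x := fun x hx => by
    rw [hext x hx, hk x hx, Matrix.smul_apply, gBar_apply, kron_succ_zero, tang_succ_right,
      kron_self]
    simp
  obtain ⟨K₀, s₀, hs₀, hK₀⟩ := hlip 0 0 hmem0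
  obtain ⟨K₁, s₁, hs₁, hK₁⟩ := hlip α₀.succ α₀.succ hmem0
  -- Positive definiteness at the boundary point 0, with continuity, keeps w above half its boundary
  -- value nearby.
  have hc : 0 < k' 0 0 0 := (hpos 0 hmem0).diag_pos
  have hcont : ContinuousWithinAt (fun x => k' x 0 0) (closedCollar n a) 0 :=
    (hlip 0 0).continuousOn 0 hmem0
  have hs₂ := hcont.eventually (lt_mem_nhds (half_lt_self hc))
  obtain ⟨r, hr, hball⟩ := Metric.mem_nhdsWithin_iff.1 (inter_mem (inter_mem hs₀ hs₁) hs₂)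
  set c := k' 0 0 0 / 2
  have hc' : 0 < c := half_pos hc
  -- With E = e^f ≤ e², the constant comes from w(x)(E(x) - E(x')) = (wE)(x) - (wE)(x') - E(x')(w(x)
  -- - w(x')), divided by w(x) > c.
  refine warp_not_lipschitz_near_zero (α₀ := α₀) h ha ha1 hr
    (((K₁ : ℝ) + Real.exp 2 * K₀) / c).toNNReal
    (LipschitzOnWith.of_dist_le_mul fun x hx x' hx' => ?_)
  rw [Real.coe_toNNReal _ (by positivity), div_mul_eq_mul_div, le_div_iff₀ hc']
  obtain ⟨⟨hx0, hx1⟩, hxw⟩ := hball ⟨hx.2, hsub hx.1⟩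
  obtain ⟨⟨hx0', hx1'⟩, -⟩ := hball ⟨hx'.2, hsub hx'.1⟩
  have d0 := hK₀.dist_le_mul x hx0 x' hx0'
  have d1 := hK₁.dist_le_mul x hx1 x' hx1'
  simp only [h00 x hx.1, h00 x' hx'.1] at d0
  simp only [hpp x hx.1, hpp x' hx'.1] at d1
  have hw : c < w x := by rw [← h00 x hx.1]; exact hxw
  have hE : |warp η α₀.succ x'| ≤ Real.exp 2 := by
    rw [abs_of_pos (warp_pos x')]
    exact warp_le h ⟨hx'.1.1, hx'.1.2.trans_le ha1⟩
  rw [Real.dist_eq] at d0 d1 ⊢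
  calc |warp η α₀.succ x - warp η α₀.succ x'| * c
      ≤ |warp η α₀.succ x - warp η α₀.succ x'| * |w x| :=
        mul_le_mul_of_nonneg_left (hw.le.trans (le_abs_self _)) (abs_nonneg _)
    _ = |(w x * warp η α₀.succ x - w x' * warp η α₀.succ x')
          - warp η α₀.succ x' * (w x - w x')| := by rw [← abs_mul]; congr 1; ring
    _ ≤ K₁ * dist x x' + Real.exp 2 * (K₀ * dist x x') := by
        refine (abs_sub _ _).trans (add_le_add d1 ?_)
        rw [abs_mul]
        exact mul_le_mul hE d0 (abs_nonneg _) (Real.exp_pos 2).le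
    _ = _ := by ring

end AHExample

theorem mainTheorem5 :
    (∃ η : ℝ → ℝ, IsCutoff η) ∧
    ∀ (n : ℕ) (α₀ : Fin n) (η : ℝ → ℝ), IsCutoff η →
      -- `g` is a smooth metric on the end, complete, with the stated curvature decay
      IsSmoothMetric (gMetric η α₀) ∧
      IsCompleteEnd (gMetric η α₀) ∧
      (∃ C : ℝ, ∀ x ∈ openCollar n 1, ∀ X Z : Coord n,
        IsOrthonormalPair (gMetric η α₀) x X Z → |sec (gMetric η α₀) x X Z - (-1)| ≤ C * x 0) ∧
      (∃ C : ℝ, ∀ x ∈ openCollar n 1, normCovRm (gMetric η α₀) x ≤ C * x 0) ∧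
      -- `ρ` is a smooth geodesic defining function, and `ḡ = ρ² g` is a continuous metric up to
      -- the boundary
      IsGeodesicDefiningFunction ∞ 1 (gMetric η α₀) (fun x => x 0) ∧
      (∀ x ∈ openCollar n 1, rescale (fun z => z 0) (gMetric η α₀) x = gBar η α₀ x) ∧
      ExtendsContinuously 1 (gBar η α₀) ∧
      -- `∂_y ḡ = O(log ρ)`, and it is unbounded near the boundary
      (∃ C : ℝ, ∀ x ∈ openCollar n 1, ∀ i j : Fin (n + 1),
        |pd α₀.succ (fun z => gBar η α₀ z i j) x| ≤ C * |Real.log (x 0)|) ∧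
      (∀ α : Fin n, ∀ a : ℝ, 0 < a → a ≤ 1 → ∀ B : ℝ, ∃ x ∈ openCollar n a,
        B < |pd α₀.succ (fun z => gBar η α₀ z α.succ α.succ) x|) ∧
      -- the compactification is not Lipschitz, on any collar of the boundary, for `ρ` or for any
      -- other geodesic defining function
      (∀ a : ℝ, 0 < a → a ≤ 1 → ¬ ExtendsLipschitz a (gBar η α₀)) ∧
      (∀ a : ℝ, 0 < a → a ≤ 1 → ∀ σ : Coord n → ℝ,
        IsGeodesicDefiningFunction 1 a (gMetric η α₀) σ →
          ¬ ExtendsLipschitz a (rescale σ (gMetric η α₀))) := by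
  refine ⟨exists_isCutoff, fun n α₀ η h => ⟨isSmoothMetric_gMetric h, isCompleteEnd_gMetric h,
    exists_abs_sec_le h, exists_normCovRm_le h, isGeodesicDefiningFunction_rho,
    fun x hx => rescale_rho_gMetric hx.1, extendsContinuously_gBar h, exists_abs_pd_gBar_le h,
    fun α a ha ha1 B => pd_gBar_unbounded h α ha ha1 B, fun a ha ha1 => ?_,
    fun a ha ha1 σ _ => ?_⟩⟩
  · exact not_extendsLipschitz_of_conformal h ha ha1 (fun _ => 1) fun x _ => (one_smul ℝ _).symm
  · exact not_extendsLipschitz_of_conformal h ha ha1 (fun x => σ x ^ 2 * (x 0 ^ 2)⁻¹)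
      fun x _ => rescale_gMetric σ x
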